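/- **Conventions.** All Hilbert spaces and C*-algebras are finite-dimensional and nonzero. A C*-algebra is represented as $\mathcal A=\bigoplus_k B(H_k)\subseteq B(H)$ with $H=\bigoplus_k H_k$, and $E_{\mathcal A}$ is the trace preserving conditional expectation $B(H)\to\mathcal A$. For $\mathcal A\subseteq B(H)$, $\mathcal B\subseteq B(K)$, $\mathcal L(\mathcal A,\mathcal B)$ is the real space of Hermitian linear maps $\mathcal A\to\mathcal B$, each identified with a map $B(H)\to B(K)$ satisfying $\phi=E_{\mathcal B}\circ\phi\circ E_{\mathcal A}$. $CP(\mathcal A,\mathcal B)\subseteq\mathcal L(\mathcal A,\mathcal B)$ is the cone of completely positive maps, and $\le$ is the order it defines. A *channel* is a trace preserving element of $CP(\mathcal A,\mathcal B)$; $\mathcal C(\mathcal A,\mathcal B)$ is the set of channels. Let $\mathbb D_n$ denote the algebra of diagonal $n\times n$ matrices, $id_D$ the identity map on $B(D)$. For $\phi\in\mathcal L(\mathcal A,\mathcal B)$ and $\psi\in\mathcal L(\mathcal B,\mathcal A)$ put $\langle\phi,\psi\rangle=s(\phi\circ\psi)$, where $s(\omega)=\sum_{i,j}\langle i|\,\omega(|i\rangle\langle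 j|)\,|j\rangle$ with respect to a fixed orthonormal basis adapted to the block decomposition. Let $CP^*(\mathcal B,\mathcal A)=\{\psi\in\mathcal L(\mathcal B,\mathcal A):\langle\phi,\psi\rangle\ge0\ \text{for all}\ \phi\in CP(\mathcal A,\mathcal B)\}$, and for $\psi\in\mathcal L(\mathcal B,\mathcal A)$ let $$\|\psi\|^\diamond=\sup\{\langle\xi,\psi\rangle:\ \xi\in\mathcal L(\mathcal A,\mathcal B),\ -\alpha\le\xi\le\alpha\ \text{for some}\ \alpha\in\mathcal C(\mathcal A,\mathcal B)\}$$ be the dual of the diamond norm on $\mathcal L(\mathcal A,\mathcal B)$. **Deficiency.** Let $\Phi\in\mathcal C(\mathcal A,\mathcal B)$, $\Psi\in\mathcal C(\mathcal A,\mathcal B')$, $\epsilon\ge0$, and let $\mathcal D$ be a C*-algebra. Write $\Psi\succeq_{\epsilon,\mathcal D}\Phi$ if for all $\Gamma\in CP^*(\mathcal D,\mathcal A)$ and $\alpha\in\mathcal C(\mathcal B,\mathcal D)$ there is $\alpha'\in\mathcal C(\mathcal B',\mathcal D)$ with $$\langle\alpha\circ\Phi,\Gamma\rangle\le\langle\alpha'\circ\Psi,\Gamma\rangle+\epsilon\|\Gamma\|^\diamond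 .$$ Write $\Psi\succeq_{\epsilon,k}\Phi$ if this holds for $\mathcal D=B(D)$ with $\dim D=k$, and $\Psi\succeq_\epsilon\Phi$ if it holds for all C*-algebras $\mathcal D$. **Theorem.** Let $\Phi\in\mathcal C(\mathcal A,\mathcal B)$, $\Psi\in\mathcal C(\mathcal A,\mathcal B')$, and let $D$ be a Hilbert space of dimension $k\ge1$. 1. If $\mathcal E$ is a C*-algebra and $\xi\in\mathcal C(\mathcal E,B(D))$ is surjective, then $\Psi\otimes\xi\succeq_{0,\mathbb D_{k^2}}\Phi\otimes\xi$ implies $\Psi\succeq_{0,k}\Phi$. 2. For every $\epsilon\ge0$, $\Psi\otimes id_D\succeq_{\epsilon,\mathbb D_{k^2}}\Phi\otimes id_D$ implies $\Psi\succeq_{\epsilon,k}\Phi$. 3. For every channel $\xi\in\mathcal C(\mathcal E,\mathcal F)$ between C*-algebras and every $\epsilon\ge0$, $\Psi\succeq_\epsilon\Phi$ implies $\Psi\otimes\xi\succeq_\epsilon\Phi\otimes\xi$. -/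

import Mathlib

open scoped Kronecker ComplexOrder

noncomputable section

namespace ChannelComparison

/-- A nonzero finite-dimensional C*-algebra in its standard representation `⨁ₖ B(Hₖ) ⊆ B(H)`,
`H = ⨁ₖ Hₖ`.  The Hilbert space `H` is `ℂ^ι` with its canonical orthonormal basis, and `Hₖ` is
spanned by the basis vectors `i` with `block i = k`. -/
structure FDCStarAlg where
  ι : Type
  Block : Type
  block : ι → Block
  [fintypeι : Fintype ι]
  [decEqι : DecidableEq ι]
  [nonemptyι : Nonempty ι]
  [decEqBlock : DecidableEq Block]

attribute [instance] FDCStarAlg.fintypeι FDCStarAlg.decEqι FDCStarAlg.nonemptyι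
  FDCStarAlg.decEqBlock

/-- The ambient matrix algebra `B(H)` of `A ⊆ B(H)`. -/
abbrev FDCStarAlg.Op (A : FDCStarAlg) : Type := Matrix A.ι A.ι ℂ

/-- The C*-algebra itself, as a unital star subalgebra of `B(H)`: the block diagonal matrices. -/
def FDCStarAlg.toStarSubalgebra (A : FDCStarAlg) : StarSubalgebra ℂ A.Op where
  carrier := {a | ∀ i j, A.block i ≠ A.block j → a i j = 0}
  mul_mem' := by
    intro a b ha hb i j hij
    rw [Matrix.mul_apply]
    refine Finset.sum_eq_zero fun l _ => ?_
    by_cases h : A.block i = A.block l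
    · rw [hb l j (fun h' => hij (h.trans h')), mul_zero]
    · rw [ha i l h, zero_mul]
  add_mem' := by
    intro a b ha hb i j hij
    simp [ha i j hij, hb i j hij]
  algebraMap_mem' := by
    intro r i j hij
    have : i ≠ j := fun h => hij (by rw [h])
    simp [Matrix.algebraMap_matrix_apply, this]
  star_mem' := by
    intro a ha i j hij
    simp [Matrix.star_apply, ha j i (Ne.symm hij)]

/-- The algebra `B(ℂⁿ)` (a single block). -/
def fullAlg (n : ℕ) [NeZero n] : FDCStarAlg where
  ι := Fin n
  Block := Unit
  block := fun _ => ()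

/-- The commutative algebra `𝔻ₙ` of diagonal `n × n` matrices (one-dimensional blocks). -/
def diagAlg (n : ℕ) [NeZero n] : FDCStarAlg where
  ι := Fin n
  Block := Fin n
  block := id

/-- The tensor product `A ⊗ B ⊆ B(H ⊗ K)`. -/
def FDCStarAlg.tensor (A B : FDCStarAlg) : FDCStarAlg where
  ι := A.ι × B.ι
  Block := A.Block × B.Block
  block := fun p => (A.block p.1, B.block p.2)

/-- The trace preserving conditional expectation `E_A` of `B(H)` onto `A`. -/
def FDCStarAlg.condExp (A : FDCStarAlg) : A.Op →ₗ[ℂ] A.Op where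
  toFun a := Matrix.of fun i j => if A.block i = A.block j then a i j else 0
  map_add' := by
    intro a b
    ext i j
    by_cases h : A.block i = A.block j <;> simp [h]
  map_smul' := by
    intro c a
    ext i j
    by_cases h : A.block i = A.block j <;> simp [h]

/-- `E_A` takes values in `A`. -/
theorem FDCStarAlg.condExp_mem (A : FDCStarAlg) (a : A.Op) :
    A.condExp a ∈ A.toStarSubalgebra := by
  intro i j h
  simp [FDCStarAlg.condExp, h]

/-- The defining property `Tr ab = Tr E_A(a)b`, for `a ∈ B(H)` and `b ∈ A`. -/
theorem FDCStarAlg.trace_condExp_mul (A : FDCStarAlg) (a b : A.Op)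
    (hb : b ∈ A.toStarSubalgebra) : (a * b).trace = (A.condExp a * b).trace := by
  simp only [Matrix.trace, Matrix.diag_apply, Matrix.mul_apply]
  refine Finset.sum_congr rfl fun i _ => Finset.sum_congr rfl fun j _ => ?_
  by_cases h : A.block i = A.block j
  · simp [FDCStarAlg.condExp, h]
  · rw [hb j i (Ne.symm h), mul_zero, mul_zero]

section Maps

variable {n m p q : Type} [Fintype n] [DecidableEq n] [Fintype m]
  [Fintype p] [DecidableEq p] [Fintype q]

/-- The tensor product `φ ⊗ ψ : B(H ⊗ H') → B(K ⊗ K')` of linear maps `φ : B(H) → B(K)` and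
`ψ : B(H') → B(K')`. -/
def mapTensor (φ : Matrix n n ℂ →ₗ[ℂ] Matrix m m ℂ) (ψ : Matrix p p ℂ →ₗ[ℂ] Matrix q q ℂ) :
    Matrix (n × p) (n × p) ℂ →ₗ[ℂ] Matrix (m × q) (m × q) ℂ where
  toFun X := ∑ i, ∑ j, ∑ k, ∑ l,
    X (i, k) (j, l) • (φ (Matrix.single i j 1) ⊗ₖ ψ (Matrix.single k l 1))
  map_add' := by
    intro X Y
    simp only [Matrix.add_apply, add_smul, Finset.sum_add_distrib]
  map_smul' := by
    intro c X
    simp only [Matrix.smul_apply, smul_eq_mul, mul_smul, Finset.smul_sum, RingHom.id_apply]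

/-- `(φ ⊗ ψ)(a ⊗ b) = φ(a) ⊗ ψ(b)`. -/
theorem mapTensor_kronecker (φ : Matrix n n ℂ →ₗ[ℂ] Matrix m m ℂ)
    (ψ : Matrix p p ℂ →ₗ[ℂ] Matrix q q ℂ) (a : Matrix n n ℂ) (b : Matrix p p ℂ) :
    mapTensor φ ψ (a ⊗ₖ b) = φ a ⊗ₖ ψ b := by
  have expand : ∀ {r s : Type} [Fintype r] [DecidableEq r] [Fintype s]
      (f : Matrix r r ℂ →ₗ[ℂ] Matrix s s ℂ) (x : Matrix r r ℂ) (u v : s),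
      f x u v = ∑ i, ∑ j, x i j * f (Matrix.single i j 1) u v := by
    intro r s _ _ _ f x u v
    conv_lhs => rw [Matrix.matrix_eq_sum_single x]
    simp only [map_sum, Matrix.sum_apply]
    refine Finset.sum_congr rfl fun i _ => Finset.sum_congr rfl fun j _ => ?_
    have : Matrix.single i j (x i j) = x i j • Matrix.single i j (1 : ℂ) := by simp
    rw [this, map_smul, Matrix.smul_apply, smul_eq_mul]
  ext ⟨u, u'⟩ ⟨v, v'⟩
  rw [Matrix.kroneckerMap_apply, expand φ a u v, expand ψ b u' v', Finset.sum_mul]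
  simp only [mapTensor, LinearMap.coe_mk, AddHom.coe_mk, Matrix.sum_apply, Matrix.smul_apply,
    Matrix.kroneckerMap_apply, smul_eq_mul]
  refine Finset.sum_congr rfl fun i _ => ?_
  rw [Finset.sum_mul]
  refine Finset.sum_congr rfl fun j _ => ?_
  rw [Finset.mul_sum]
  refine Finset.sum_congr rfl fun k _ => ?_
  rw [Finset.mul_sum]
  refine Finset.sum_congr rfl fun l _ => ?_
  ring

/-- `φ(B(H)⁺) ⊆ B(K)⁺`. -/
def IsPositiveMap (φ : Matrix n n ℂ →ₗ[ℂ] Matrix m m ℂ) : Prop :=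
  ∀ a : Matrix n n ℂ, a.PosSemidef → (φ a).PosSemidef

/-- `φ ⊗ id_F` is positive for every finite-dimensional Hilbert space `F`. -/
def IsCompletelyPositive (φ : Matrix n n ℂ →ₗ[ℂ] Matrix m m ℂ) : Prop :=
  ∀ r : ℕ, IsPositiveMap (mapTensor φ (LinearMap.id : Matrix (Fin r) (Fin r) ℂ →ₗ[ℂ] _))

/-- `s(φ) = ∑ᵢⱼ ⟨i, φ(|i⟩⟨j|) j⟩`; on Hermitian maps the sum is real. -/
def sFunctional (φ : Matrix n n ℂ →ₗ[ℂ] Matrix n n ℂ) : ℝ :=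
  (∑ i, ∑ j, φ (Matrix.single i j 1) i j).re

/-- The duality `⟨φ, ψ⟩ = s(φ ∘ ψ)`. -/
def pairing [DecidableEq m] (φ : Matrix n n ℂ →ₗ[ℂ] Matrix m m ℂ)
    (ψ : Matrix m m ℂ →ₗ[ℂ] Matrix n n ℂ) : ℝ :=
  sFunctional (φ ∘ₗ ψ)

end Maps

/-- `𝓛(A, B)`: the real linear space of Hermitian maps `φ : B(H) → B(K)` of the form
`φ = E_B ∘ φ ∘ E_A`, i.e. (extensions by `E_A` of) linear maps `A_h → B_h`. -/
def hermMaps (A B : FDCStarAlg) : Submodule ℝ (A.Op →ₗ[ℂ] B.Op) where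
  carrier := {φ | (∀ a, φ a.conjTranspose = (φ a).conjTranspose) ∧
    B.condExp ∘ₗ φ ∘ₗ A.condExp = φ}
  add_mem' := by
    rintro φ ψ ⟨h1, h2⟩ ⟨h3, h4⟩
    refine ⟨fun a => by simp [h1, h3], ?_⟩
    rw [LinearMap.add_comp, LinearMap.comp_add, h2, h4]
  zero_mem' := ⟨fun a => by simp, by simp⟩
  smul_mem' := by
    rintro c φ ⟨h1, h2⟩
    refine ⟨fun a => ?_, ?_⟩
    · ext i j
      simp [h1]
    · ext1 a
      have h := LinearMap.congr_fun h2 a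
      simp only [LinearMap.comp_apply] at h
      simp only [LinearMap.comp_apply, LinearMap.smul_apply]
      rw [← Complex.coe_smul, map_smul, h, Complex.coe_smul]

/-- The cone `CP(A, B)`. -/
def cpCone (A B : FDCStarAlg) : Set (A.Op →ₗ[ℂ] B.Op) :=
  {φ | φ ∈ hermMaps A B ∧ IsCompletelyPositive φ}

/-- The dual cone `CP*(B, A) ⊆ 𝓛(B, A)` of `CP(A, B)` with respect to the duality. -/
def cpDualCone (B A : FDCStarAlg) : Set (B.Op →ₗ[ℂ] A.Op) :=
  {ψ | ψ ∈ hermMaps B A ∧ ∀ φ ∈ cpCone A B, 0 ≤ pairing φ ψ}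

/-- `𝓒(A, B)`: channels, the trace preserving elements of `CP(A, B)`. -/
def channels (A B : FDCStarAlg) : Set (A.Op →ₗ[ℂ] B.Op) :=
  {φ | φ ∈ cpCone A B ∧ ∀ a, (φ a).trace = a.trace}

/-- For a cone `Q` and a base section `S` of `Q`, the set `{x | ∃ b ∈ S, -b ≤ x ≤ b}`, where `≤` is
the order given by `Q`. -/
def sectionBall {V : Type*} [AddCommGroup V] (Q S : Set V) : Set V :=
  {x | ∃ b ∈ S, x + b ∈ Q ∧ b - x ∈ Q}

/-- The norm `‖·‖^⋄` on `𝓛(B, A)`, dual to the diamond norm `‖·‖_⋄` on `𝓛(A, B)`: the supremum of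
`⟨ξ, ψ⟩` over all `ξ` in the unit ball of `‖·‖_⋄`, which is the set of all `ξ` with `-α ≤ ξ ≤ α`
(in the order given by `CP(A, B)`) for some channel `α ∈ 𝓒(A, B)`. -/
def dualDiamondNorm (B A : FDCStarAlg) (ψ : B.Op →ₗ[ℂ] A.Op) : ℝ :=
  sSup {r | ∃ ξ ∈ sectionBall (cpCone A B) (channels A B), r = pairing ξ ψ}

/-- `Ψ ⪰_{ε, D} Φ`: the map `Ψ` is `(ε, D)`-post-processing deficient with respect to `Φ`,
where `Φ ∈ 𝓒(A, B)` and `Ψ ∈ 𝓒(A, B')`. -/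
def DeficientFor {A B B' : FDCStarAlg} (ε : ℝ) (D : FDCStarAlg)
    (Ψ : A.Op →ₗ[ℂ] B'.Op) (Φ : A.Op →ₗ[ℂ] B.Op) : Prop :=
  ∀ Γ ∈ cpDualCone D A, ∀ α ∈ channels B D, ∃ α' ∈ channels B' D,
    pairing (α ∘ₗ Φ) Γ ≤ pairing (α' ∘ₗ Ψ) Γ + ε * dualDiamondNorm D A Γ

/-- `Ψ ⪰_ε Φ`: deficiency for all decision algebras. -/
def Deficient {A B B' : FDCStarAlg} (ε : ℝ)
    (Ψ : A.Op →ₗ[ℂ] B'.Op) (Φ : A.Op →ₗ[ℂ] B.Op) : Prop :=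
  ∀ D : FDCStarAlg, DeficientFor ε D Ψ Φ

/-- The tensor product `Φ ⊗ ξ` as a map from `A ⊗ E` to `B ⊗ F`. -/
def tensorMap {A B E F : FDCStarAlg} (Φ : A.Op →ₗ[ℂ] B.Op) (ξ : E.Op →ₗ[ℂ] F.Op) :
    (A.tensor E).Op →ₗ[ℂ] (B.tensor F).Op :=
  mapTensor (n := A.ι) (m := B.ι) (p := E.ι) (q := F.ι) Φ ξ

end ChannelComparison

end

/-! Tensoring is harmless because deficiency is equivalent to an operator inequality. Taking the
decision algebra to be the output algebra `B` itself, `DeficientFor.exists_channels` produces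
channels `α`, `c` with `Φ ≤ α ∘ Ψ + ε c` in the completely positive order. This is a minimax
statement, proved by separating the compact convex set of all `α ∘ Ψ + ε c - Φ` from the closed cone
of CP maps: a separating functional is a pairing with some `Γ` in the dual cone, and the deficiency
inequality for that `Γ` contradicts the separation. The inequality survives tensoring with `ξ` and
post-composition with a channel, and pairing it with `Γ` gives the third claim.

The other two claims rest on teleportation. `teleport` turns a CP map `A ⊗ D → S`, with `S` having
`k²` classical outcomes, into a CP map `A → D`; it sends channels to channels, commutes with
processing of `A`, and recovers any channel `α` from the Bell measurement of `α ⊗ id`. Hence `β ↦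
⟨teleport β, Γ⟩` is pairing with an element of the dual cone for `S`, of no larger norm, and a good
`β'` for it teleports to a good `α'`. For surjective `ξ`, a linear right inverse `η` is inserted
first. Since `η` need not be positive, neither need be the functional; adding a multiple of `Tr
β(1)`, which is constant on channels, repairs this. The shift may increase the norm, which does not
matter when `ε = 0`. -/

namespace ChannelComparison

/-! ### Kraus decompositions of completely positive maps. -/

section Kraus

set_option linter.unusedSectionVars false

open Matrix

variable {n m p q : Type} [Fintype n] [DecidableEq n] [Fintype m] [DecidableEq m]
  [Fintype p] [DecidableEq p] [Fintype q] [DecidableEq q]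

/-- Linear maps on matrices are determined by their values on matrix units. -/
theorem linearMap_ext_single {W : Type*} [AddCommMonoid W] [Module ℂ W]
    {f g : Matrix n m ℂ →ₗ[ℂ] W} (h : ∀ i j, f (single i j 1) = g (single i j 1)) : f = g := by
  refine Matrix.ext_linearMap ℂ fun i j => LinearMap.ext_ring ?_
  simpa using h i j

/-- Linear maps on a tensor product are determined by their values on elementary tensors. -/
theorem linearMap_ext_kronecker {W : Type*} [AddCommMonoid W] [Module ℂ W]
    {f g : Matrix (n × p) (n × p) ℂ →ₗ[ℂ] W}
    (h : ∀ (a : Matrix n n ℂ) (b : Matrix p p ℂ), f (a ⊗ₖ b) = g (a ⊗ₖ b)) : f = g := by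
  refine linearMap_ext_single fun i j => ?_
  have := h (single i.1 j.1 1) (single i.2 j.2 1)
  simpa [single_kronecker_single] using this

omit [Fintype m] [DecidableEq m] in
/-- The value of a linear map in coordinates. -/
theorem linearMap_apply_eq_sum (φ : Matrix n n ℂ →ₗ[ℂ] Matrix m m ℂ) (x : Matrix n n ℂ) (u v : m) :
    φ x u v = ∑ i, ∑ j, x i j * φ (single i j 1) u v := by
  conv_lhs => rw [matrix_eq_sum_single x]
  simp only [map_sum, Matrix.sum_apply]
  refine Finset.sum_congr rfl fun i _ => Finset.sum_congr rfl fun j _ => ?_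
  have : single i j (x i j) = x i j • single i j (1 : ℂ) := by simp
  rw [this, map_smul, Matrix.smul_apply, smul_eq_mul]

theorem mapTensor_comp {n' p' : Type} [Fintype n'] [DecidableEq n'] [Fintype p'] [DecidableEq p']
    (φ : Matrix n n ℂ →ₗ[ℂ] Matrix m m ℂ)
    (ψ : Matrix p p ℂ →ₗ[ℂ] Matrix q q ℂ) (φ' : Matrix n' n' ℂ →ₗ[ℂ] Matrix n n ℂ)
    (ψ' : Matrix p' p' ℂ →ₗ[ℂ] Matrix p p ℂ) :
    mapTensor (φ ∘ₗ φ') (ψ ∘ₗ ψ') = mapTensor φ ψ ∘ₗ mapTensor φ' ψ' :=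
  linearMap_ext_kronecker fun a b => by simp [mapTensor_kronecker]

/-- The map `x ↦ ∑ᵣ Kᵣ x Kᵣ*`. -/
def krausMap {κ : Type} [Fintype κ] (K : κ → Matrix m n ℂ) :
    Matrix n n ℂ →ₗ[ℂ] Matrix m m ℂ where
  toFun x := ∑ r, K r * x * (K r)ᴴ
  map_add' x y := by simp [Matrix.mul_add, Matrix.add_mul, Finset.sum_add_distrib]
  map_smul' c x := by simp [Finset.smul_sum]

theorem krausMap_apply {κ : Type} [Fintype κ] (K : κ → Matrix m n ℂ) (x : Matrix n n ℂ) :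
    krausMap K x = ∑ r, K r * x * (K r)ᴴ := rfl

theorem krausMap_comp {κ κ' : Type} [Fintype κ] [Fintype κ'] (K : κ → Matrix m n ℂ)
    (L : κ' → Matrix n p ℂ) :
    krausMap K ∘ₗ krausMap L = krausMap fun r : κ × κ' => K r.1 * L r.2 := by
  ext1 x
  simp only [LinearMap.comp_apply, krausMap_apply, Fintype.sum_prod_type, Matrix.mul_sum,
    Matrix.sum_mul, Matrix.mul_assoc, conjTranspose_mul]

theorem mapTensor_krausMap {κ κ' : Type} [Fintype κ] [Fintype κ'] (K : κ → Matrix m n ℂ)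
    (L : κ' → Matrix q p ℂ) :
    mapTensor (krausMap K) (krausMap L) = krausMap fun r : κ × κ' => K r.1 ⊗ₖ L r.2 := by
  refine linearMap_ext_kronecker fun a b => ?_
  rw [mapTensor_kronecker]
  simp only [krausMap_apply, Fintype.sum_prod_type, conjTranspose_kronecker, ← mul_kronecker_mul]
  ext ⟨i, i'⟩ ⟨j, j'⟩
  simp [Matrix.sum_apply, Finset.sum_mul_sum]

theorem krausMap_one : krausMap (fun _ : Unit => (1 : Matrix n n ℂ)) = LinearMap.id := by
  ext1 x
  simp [krausMap_apply]

theorem krausMap_posSemidef {κ : Type} [Fintype κ] (K : κ → Matrix m n ℂ) :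
    IsPositiveMap (krausMap K) := fun _ ha =>
  posSemidef_sum _ fun r _ => ha.mul_mul_conjTranspose_same (K r)

theorem krausMap_apply_single {κ : Type} [Fintype κ] (K : κ → Matrix m n ℂ) (i j : n) (u v : m) :
    krausMap K (single i j 1) u v = ∑ r, K r u i * star (K r v j) := by
  simp [krausMap_apply, Matrix.sum_apply, Matrix.mul_apply, single_apply, ite_and]

theorem krausMap_apply_apply {κ : Type} [Fintype κ] (K : κ → Matrix m n ℂ) (x : Matrix n n ℂ)
    (u v : m) :
    krausMap K x u v = ∑ r, ∑ i, ∑ j, K r u i * x i j * star (K r v j) := by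
  simp only [krausMap_apply, Matrix.sum_apply, Matrix.mul_apply, conjTranspose_apply,
    Finset.sum_mul]
  exact Finset.sum_congr rfl fun r _ => Finset.sum_comm

open scoped MatrixOrder in
theorem exists_eq_conjTranspose_mul_self {C : Matrix n n ℂ} (hC : C.PosSemidef) :
    ∃ D : Matrix n n ℂ, C = Dᴴ * D :=
  CStarAlgebra.nonneg_iff_eq_star_mul_self.1 hC.nonneg

/-- Completely positive maps are the maps with a Kraus decomposition. -/
theorem isCompletelyPositive_iff (φ : Matrix n n ℂ →ₗ[ℂ] Matrix m m ℂ) :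
    IsCompletelyPositive φ ↔
      ∃ (κ : Type) (_ : Fintype κ) (K : κ → Matrix m n ℂ), φ = krausMap K := by
  constructor
  · intro h
    let e := Fintype.equivFin n
    -- The unnormalised maximally entangled vector; `φ ⊗ id` sends its projection to the Choi matrix
    -- of `φ`.
    let v : n × Fin (Fintype.card n) → ℂ := fun x => if e x.1 = x.2 then 1 else 0
    have hC := h (Fintype.card n) (vecMulVec v (star v)) (posSemidef_vecMulVec_self_star v)
    have hentry : ∀ i j u w, mapTensor φ
        (LinearMap.id : Matrix (Fin (Fintype.card n)) (Fin (Fintype.card n)) ℂ →ₗ[ℂ] _)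
        (vecMulVec v (star v)) (u, e i) (w, e j) = φ (single i j 1) u w := by
      intro i j u w
      simp [mapTensor, Matrix.sum_apply, vecMulVec_apply, v, single_apply, ite_and]
    obtain ⟨D, hD⟩ := exists_eq_conjTranspose_mul_self hC
    -- Each row of the factor `D` of the Choi matrix, reshaped and conjugated, is a Kraus operator.
    refine ⟨_, inferInstance, fun t => of fun u i => star (D t (u, e i)), ?_⟩
    refine linearMap_ext_single fun i j => ?_
    ext u w
    rw [krausMap_apply_single, ← hentry, hD]
    simp [Matrix.mul_apply]
  · rintro ⟨κ, _, K, rfl⟩ r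
    rw [← krausMap_one, mapTensor_krausMap]
    exact krausMap_posSemidef _

theorem isCompletelyPositive_krausMap {κ : Type} [Fintype κ] (K : κ → Matrix m n ℂ) :
    IsCompletelyPositive (krausMap K) :=
  (isCompletelyPositive_iff _).2 ⟨κ, _, K, rfl⟩

theorem IsCompletelyPositive.comp {φ : Matrix n n ℂ →ₗ[ℂ] Matrix m m ℂ}
    {ψ : Matrix p p ℂ →ₗ[ℂ] Matrix n n ℂ} (hφ : IsCompletelyPositive φ)
    (hψ : IsCompletelyPositive ψ) : IsCompletelyPositive (φ ∘ₗ ψ) := by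
  obtain ⟨κ, _, K, rfl⟩ := (isCompletelyPositive_iff _).1 hφ
  obtain ⟨κ', _, L, rfl⟩ := (isCompletelyPositive_iff _).1 hψ
  rw [krausMap_comp]
  exact isCompletelyPositive_krausMap _

theorem IsCompletelyPositive.mapTensor {φ : Matrix n n ℂ →ₗ[ℂ] Matrix m m ℂ}
    {ψ : Matrix p p ℂ →ₗ[ℂ] Matrix q q ℂ} (hφ : IsCompletelyPositive φ)
    (hψ : IsCompletelyPositive ψ) : IsCompletelyPositive (mapTensor φ ψ) := by
  obtain ⟨κ, _, K, rfl⟩ := (isCompletelyPositive_iff _).1 hφ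
  obtain ⟨κ', _, L, rfl⟩ := (isCompletelyPositive_iff _).1 hψ
  rw [mapTensor_krausMap]
  exact isCompletelyPositive_krausMap _

theorem IsCompletelyPositive.add {φ ψ : Matrix n n ℂ →ₗ[ℂ] Matrix m m ℂ}
    (hφ : IsCompletelyPositive φ) (hψ : IsCompletelyPositive ψ) :
    IsCompletelyPositive (φ + ψ) := by
  obtain ⟨κ, _, K, rfl⟩ := (isCompletelyPositive_iff _).1 hφ
  obtain ⟨κ', _, L, rfl⟩ := (isCompletelyPositive_iff _).1 hψ
  refine (isCompletelyPositive_iff _).2 ⟨κ ⊕ κ', inferInstance, Sum.elim K L, ?_⟩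
  ext1 x
  simp [krausMap_apply]

theorem IsCompletelyPositive.smul {φ : Matrix n n ℂ →ₗ[ℂ] Matrix m m ℂ}
    (hφ : IsCompletelyPositive φ) {c : ℝ} (hc : 0 ≤ c) : IsCompletelyPositive (c • φ) := by
  obtain ⟨κ, _, K, rfl⟩ := (isCompletelyPositive_iff _).1 hφ
  refine (isCompletelyPositive_iff _).2 ⟨κ, inferInstance, fun r => (Real.sqrt c : ℂ) • K r, ?_⟩
  ext1 x
  have : (Real.sqrt c : ℂ) * Real.sqrt c = c := by
    rw [← Complex.ofReal_mul, Real.mul_self_sqrt hc]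
  simp only [LinearMap.smul_apply, krausMap_apply, Finset.smul_sum, conjTranspose_smul,
    Matrix.smul_mul, Matrix.mul_smul, smul_smul]
  refine Finset.sum_congr rfl fun r _ => ?_
  rw [RCLike.star_def, Complex.conj_ofReal, this, Complex.coe_smul]

theorem IsCompletelyPositive.map_conjTranspose {φ : Matrix n n ℂ →ₗ[ℂ] Matrix m m ℂ}
    (hφ : IsCompletelyPositive φ) (a : Matrix n n ℂ) : φ aᴴ = (φ a)ᴴ := by
  obtain ⟨κ, _, K, rfl⟩ := (isCompletelyPositive_iff _).1 hφ
  simp [krausMap_apply, conjTranspose_sum, Matrix.mul_assoc]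

/-- The coefficients of a completely positive map are dominated by `Tr φ(1)`. -/
theorem IsCompletelyPositive.norm_apply_single_le {φ : Matrix n n ℂ →ₗ[ℂ] Matrix m m ℂ}
    (hφ : IsCompletelyPositive φ) (i j : n) (u v : m) :
    ‖φ (single i j 1) u v‖ ≤ (φ 1).trace.re := by
  obtain ⟨κ, _, K, rfl⟩ := (isCompletelyPositive_iff _).1 hφ
  have htr : (krausMap K 1).trace.re = ∑ r, ∑ u, ∑ i, ‖K r u i‖ ^ 2 := by
    simp only [krausMap_apply, trace_sum, Matrix.mul_one, Complex.re_sum]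
    refine Finset.sum_congr rfl fun r _ => ?_
    simp only [trace, diag_apply, Matrix.mul_apply, Complex.re_sum, conjTranspose_apply]
    refine Finset.sum_congr rfl fun u _ => Finset.sum_congr rfl fun i _ => ?_
    rw [RCLike.star_def, Complex.mul_conj, Complex.ofReal_re, Complex.normSq_eq_norm_sq]
  rw [htr, krausMap_apply_single]
  refine (norm_sum_le _ _).trans (Finset.sum_le_sum fun r _ => ?_)
  have hle : ∀ u i, ‖K r u i‖ ^ 2 ≤ ∑ u, ∑ i, ‖K r u i‖ ^ 2 := fun u i =>
    (Finset.single_le_sum (f := fun i => ‖K r u i‖ ^ 2) (fun _ _ => by positivity)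
      (Finset.mem_univ i)).trans
    (Finset.single_le_sum (f := fun u => ∑ i, ‖K r u i‖ ^ 2) (fun _ _ => by positivity)
      (Finset.mem_univ u))
  rw [norm_mul, norm_star]
  -- `xy ≤ (x² + y²) / 2`, with both squares bounded by the full Hilbert-Schmidt sum.
  nlinarith [hle u i, hle v j, sq_nonneg (‖K r u i‖ - ‖K r v j‖)]

end Kraus

/-! ### Cones of CP maps and sets of channels, under composition and tensor product. -/

section Cones

open Matrix

theorem FDCStarAlg.condExp_apply (A : FDCStarAlg) (a : A.Op) (i j : A.ι) :
    A.condExp a i j = if A.block i = A.block j then a i j else 0 := rfl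

theorem FDCStarAlg.condExp_comp_condExp (A : FDCStarAlg) : A.condExp ∘ₗ A.condExp = A.condExp := by
  ext1 a
  ext i j
  by_cases h : A.block i = A.block j <;> simp [FDCStarAlg.condExp_apply, h]

theorem FDCStarAlg.trace_condExp (A : FDCStarAlg) (a : A.Op) :
    (A.condExp a).trace = a.trace := by
  simp [Matrix.trace, FDCStarAlg.condExp_apply]

/-- The conditional expectation is `x ↦ ∑ₖ Pₖ x Pₖ`, with the block projections `Pₖ`. -/
theorem FDCStarAlg.isCompletelyPositive_condExp (A : FDCStarAlg) :
    IsCompletelyPositive A.condExp := by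
  -- `Block` need not be finite, so only the labels that occur index the Kraus operators.
  refine (isCompletelyPositive_iff _).2 ⟨Finset.univ.image A.block, inferInstance,
    fun b => diagonal fun i => if A.block i = b then 1 else 0, ?_⟩
  ext1 a
  ext i j
  have h := Finset.sum_coe_sort (Finset.univ.image A.block)
    (fun b => if A.block i = b then (if A.block j = b then a i j else 0) else 0)
  simp only [krausMap_apply, diagonal_conjTranspose, Matrix.sum_apply, mul_diagonal, diagonal_mul,
    FDCStarAlg.condExp_apply]
  have h' : ∀ b : Finset.univ.image A.block,
      (if A.block i = b then (1 : ℂ) else 0) * a i j *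
        (star fun i => if A.block i = b then (1 : ℂ) else 0) j =
      if A.block i = b then (if A.block j = b then a i j else 0) else 0 := by
    intro b
    by_cases h1 : A.block i = b <;> by_cases h2 : A.block j = b <;> simp [h1, h2]
  rw [Finset.sum_congr rfl fun b _ => h' b, h, Finset.sum_ite_eq]
  simp [eq_comm]

/-- The elementary tensor `a ⊗ b`, as an operator for the algebra `A ⊗ B`. -/
def FDCStarAlg.kron {A B : FDCStarAlg} (a : A.Op) (b : B.Op) : (A.tensor B).Op :=
  (a ⊗ₖ b : Matrix (A.ι × B.ι) (A.ι × B.ι) ℂ)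

theorem FDCStarAlg.linearMap_ext_kron {A B : FDCStarAlg} {W : Type*} [AddCommMonoid W] [Module ℂ W]
    {f g : (A.tensor B).Op →ₗ[ℂ] W} (h : ∀ a b, f (kron a b) = g (kron a b)) : f = g :=
  linearMap_ext_kronecker (n := A.ι) (p := B.ι) h

theorem FDCStarAlg.trace_kron {A B : FDCStarAlg} (a : A.Op) (b : B.Op) :
    (kron a b).trace = a.trace * b.trace :=
  trace_kronecker a b

theorem tensorMap_kron {A B E F : FDCStarAlg} (φ : A.Op →ₗ[ℂ] B.Op) (ψ : E.Op →ₗ[ℂ] F.Op)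
    (a : A.Op) (b : E.Op) :
    tensorMap φ ψ (FDCStarAlg.kron a b) = FDCStarAlg.kron (φ a) (ψ b) :=
  mapTensor_kronecker _ _ _ _

theorem FDCStarAlg.condExp_kron {A B : FDCStarAlg} (a : A.Op) (b : B.Op) :
    (A.tensor B).condExp (kron a b) = kron (A.condExp a) (B.condExp b) := by
  ext i j
  change (if (A.block i.1, B.block i.2) = (A.block j.1, B.block j.2) then
    a i.1 j.1 * b i.2 j.2 else 0) = (if A.block i.1 = A.block j.1 then a i.1 j.1 else 0) *
      (if B.block i.2 = B.block j.2 then b i.2 j.2 else 0)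
  by_cases h : A.block i.1 = A.block j.1 <;> by_cases h' : B.block i.2 = B.block j.2 <;>
    simp [h, h']

theorem FDCStarAlg.condExp_tensor (A B : FDCStarAlg) :
    (A.tensor B).condExp = tensorMap A.condExp B.condExp :=
  FDCStarAlg.linearMap_ext_kron fun a b => by
    rw [FDCStarAlg.condExp_kron, tensorMap_kron]

theorem FDCStarAlg.condExp_fullAlg (k : ℕ) [NeZero k] :
    (fullAlg k).condExp = LinearMap.id := by
  ext1 a
  ext i j
  exact (FDCStarAlg.condExp_apply _ _ _ _).trans (if_pos rfl)

variable {A B C E F : FDCStarAlg}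

theorem tensorMap_comp (φ : B.Op →ₗ[ℂ] C.Op) (φ' : A.Op →ₗ[ℂ] B.Op) {E F G : FDCStarAlg}
    (ψ : F.Op →ₗ[ℂ] G.Op) (ψ' : E.Op →ₗ[ℂ] F.Op) :
    tensorMap (φ ∘ₗ φ') (ψ ∘ₗ ψ') = tensorMap φ ψ ∘ₗ tensorMap φ' ψ' :=
  mapTensor_comp _ _ _ _

theorem condExp_comp_of_mem {φ : A.Op →ₗ[ℂ] B.Op} (h : φ ∈ hermMaps A B) :
    B.condExp ∘ₗ φ = φ := by
  rw [← h.2, ← LinearMap.comp_assoc, B.condExp_comp_condExp]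

theorem comp_condExp_of_mem {φ : A.Op →ₗ[ℂ] B.Op} (h : φ ∈ hermMaps A B) :
    φ ∘ₗ A.condExp = φ := by
  rw [← h.2, LinearMap.comp_assoc, LinearMap.comp_assoc, A.condExp_comp_condExp]

/-- The Kraus form makes Hermiticity automatic. -/
theorem mem_cpCone_iff {φ : A.Op →ₗ[ℂ] B.Op} : φ ∈ cpCone A B ↔
    IsCompletelyPositive φ ∧ B.condExp ∘ₗ φ ∘ₗ A.condExp = φ :=
  ⟨fun h => ⟨h.2, h.1.2⟩, fun h => ⟨⟨h.1.map_conjTranspose, h.2⟩, h.1⟩⟩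

theorem mem_cpCone_of_comp_eq {φ : A.Op →ₗ[ℂ] B.Op} (h : IsCompletelyPositive φ)
    (h1 : B.condExp ∘ₗ φ = φ) (h2 : φ ∘ₗ A.condExp = φ) : φ ∈ cpCone A B :=
  mem_cpCone_iff.2 ⟨h, by rw [h2, h1]⟩

theorem cpCone_comp {φ : B.Op →ₗ[ℂ] C.Op} {ψ : A.Op →ₗ[ℂ] B.Op} (hφ : φ ∈ cpCone B C)
    (hψ : ψ ∈ cpCone A B) : φ ∘ₗ ψ ∈ cpCone A C :=
  mem_cpCone_of_comp_eq (hφ.2.comp hψ.2)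
    (by rw [← LinearMap.comp_assoc, condExp_comp_of_mem hφ.1])
    (by rw [LinearMap.comp_assoc, comp_condExp_of_mem hψ.1])

theorem cpCone_tensorMap {φ : A.Op →ₗ[ℂ] B.Op} {ψ : E.Op →ₗ[ℂ] F.Op} (hφ : φ ∈ cpCone A B)
    (hψ : ψ ∈ cpCone E F) : tensorMap φ ψ ∈ cpCone (A.tensor E) (B.tensor F) :=
  mem_cpCone_of_comp_eq (hφ.2.mapTensor hψ.2)
    (by rw [FDCStarAlg.condExp_tensor, ← tensorMap_comp, condExp_comp_of_mem hφ.1,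
      condExp_comp_of_mem hψ.1])
    (by rw [FDCStarAlg.condExp_tensor, ← tensorMap_comp, comp_condExp_of_mem hφ.1,
      comp_condExp_of_mem hψ.1])

theorem cpCone_add {φ ψ : A.Op →ₗ[ℂ] B.Op} (hφ : φ ∈ cpCone A B) (hψ : ψ ∈ cpCone A B) :
    φ + ψ ∈ cpCone A B :=
  ⟨add_mem hφ.1 hψ.1, hφ.2.add hψ.2⟩

theorem cpCone_smul {φ : A.Op →ₗ[ℂ] B.Op} (hφ : φ ∈ cpCone A B) {c : ℝ} (hc : 0 ≤ c) :
    c • φ ∈ cpCone A B :=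
  ⟨Submodule.smul_mem _ c hφ.1, hφ.2.smul hc⟩

theorem zero_mem_cpCone : (0 : A.Op →ₗ[ℂ] B.Op) ∈ cpCone A B := by
  refine ⟨zero_mem _, (isCompletelyPositive_iff _).2 ⟨Empty, inferInstance, Empty.elim, ?_⟩⟩
  ext1 x
  simp [krausMap_apply]

theorem condExp_mem_channels : A.condExp ∈ channels A A :=
  ⟨mem_cpCone_of_comp_eq A.isCompletelyPositive_condExp A.condExp_comp_condExp
    A.condExp_comp_condExp, A.trace_condExp⟩

theorem channels_comp {φ : B.Op →ₗ[ℂ] C.Op} {ψ : A.Op →ₗ[ℂ] B.Op} (hφ : φ ∈ channels B C)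
    (hψ : ψ ∈ channels A B) : φ ∘ₗ ψ ∈ channels A C :=
  ⟨cpCone_comp hφ.1 hψ.1, fun a => (hφ.2 _).trans (hψ.2 a)⟩

theorem channels_tensorMap {φ : A.Op →ₗ[ℂ] B.Op} {ψ : E.Op →ₗ[ℂ] F.Op} (hφ : φ ∈ channels A B)
    (hψ : ψ ∈ channels E F) : tensorMap φ ψ ∈ channels (A.tensor E) (B.tensor F) := by
  refine ⟨cpCone_tensorMap hφ.1 hψ.1, ?_⟩
  have h : traceLinearMap (B.tensor F).ι ℂ ℂ ∘ₗ tensorMap φ ψ =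
      traceLinearMap (A.tensor E).ι ℂ ℂ := by
    refine FDCStarAlg.linearMap_ext_kron fun a b => ?_
    rw [LinearMap.comp_apply, tensorMap_kron, traceLinearMap_apply, traceLinearMap_apply,
      FDCStarAlg.trace_kron, FDCStarAlg.trace_kron, hφ.2, hψ.2]
  exact LinearMap.congr_fun h

theorem convex_cpCone : Convex ℝ (cpCone A B) := fun _ hx _ hy _ _ ha hb _ =>
  cpCone_add (cpCone_smul hx ha) (cpCone_smul hy hb)

theorem convex_channels : Convex ℝ (channels A B) := by
  intro x hx y hy a b ha hb hab
  refine ⟨convex_cpCone hx.1 hy.1 ha hb hab, fun z => ?_⟩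
  have hab' : (a : ℂ) + b = 1 := by exact_mod_cast hab
  simp only [LinearMap.add_apply, LinearMap.smul_apply, trace_add, trace_smul, hx.2, hy.2,
    Complex.real_smul]
  rw [← add_mul, hab', one_mul]

theorem FDCStarAlg.kron_sub_left {A B : FDCStarAlg} (a a' : A.Op) (b : B.Op) :
    kron (a - a') b = kron a b - kron a' b := by
  ext i j
  exact sub_mul _ _ _

theorem FDCStarAlg.kron_smul_left {A B : FDCStarAlg} (c : ℝ) (a : A.Op) (b : B.Op) :
    kron (c • a) b = c • kron a b := by
  ext i j
  exact smul_mul_assoc c (a i.1 j.1) (b i.2 j.2)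

theorem FDCStarAlg.kron_add_left {A B : FDCStarAlg} (a a' : A.Op) (b : B.Op) :
    kron (a + a') b = kron a b + kron a' b := by
  ext i j
  exact add_mul _ _ _

theorem tensorMap_add (φ φ' : A.Op →ₗ[ℂ] B.Op) (ψ : E.Op →ₗ[ℂ] F.Op) :
    tensorMap (φ + φ') ψ = tensorMap φ ψ + tensorMap φ' ψ := by
  refine FDCStarAlg.linearMap_ext_kron fun a b => ?_
  simp only [LinearMap.add_apply, tensorMap_kron, FDCStarAlg.kron_add_left]

theorem tensorMap_sub (φ φ' : A.Op →ₗ[ℂ] B.Op) (ψ : E.Op →ₗ[ℂ] F.Op) :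
    tensorMap (φ - φ') ψ = tensorMap φ ψ - tensorMap φ' ψ := by
  refine FDCStarAlg.linearMap_ext_kron fun a b => ?_
  simp only [LinearMap.sub_apply, tensorMap_kron, FDCStarAlg.kron_sub_left]

theorem tensorMap_smul (c : ℝ) (φ : A.Op →ₗ[ℂ] B.Op) (ψ : E.Op →ₗ[ℂ] F.Op) :
    tensorMap (c • φ) ψ = c • tensorMap φ ψ := by
  refine FDCStarAlg.linearMap_ext_kron fun a b => ?_
  simp only [LinearMap.smul_apply, tensorMap_kron, FDCStarAlg.kron_smul_left]

end Cones

/-! ### The trace pairing and representation of functionals. -/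

section Duality

set_option linter.unusedSectionVars false

open Matrix

variable {n m : Type} [Fintype n] [DecidableEq n] [Fintype m] [DecidableEq m]

/-- `ω(Eᵢⱼ)ᵢⱼ` is the diagonal coefficient of `ω` in the basis of matrix units. Cyclicity of the
trace thereby becomes available for the pairing. -/
theorem sFunctional_eq_re_trace (ω : Matrix n n ℂ →ₗ[ℂ] Matrix n n ℂ) :
    sFunctional ω = (LinearMap.trace ℂ _ ω).re := by
  rw [LinearMap.trace_eq_matrix_trace ℂ (Matrix.stdBasis ℂ n n), sFunctional, Matrix.trace,
    Fintype.sum_prod_type]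
  congr 1
  refine Finset.sum_congr rfl fun i _ => Finset.sum_congr rfl fun j _ => ?_
  rw [diag_apply, LinearMap.toMatrix_apply, Matrix.stdBasis_eq_single]
  simp [Matrix.stdBasis]

theorem pairing_eq_re_trace (φ : Matrix n n ℂ →ₗ[ℂ] Matrix m m ℂ)
    (ψ : Matrix m m ℂ →ₗ[ℂ] Matrix n n ℂ) :
    pairing φ ψ = (LinearMap.trace ℂ _ (φ ∘ₗ ψ)).re :=
  sFunctional_eq_re_trace _

theorem pairing_comm (φ : Matrix n n ℂ →ₗ[ℂ] Matrix m m ℂ)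
    (ψ : Matrix m m ℂ →ₗ[ℂ] Matrix n n ℂ) : pairing φ ψ = pairing ψ φ := by
  rw [pairing_eq_re_trace, pairing_eq_re_trace, LinearMap.trace_comp_comm']

/-- The pairing as a linear functional of its first argument. -/
def pairingLeft (ψ : Matrix m m ℂ →ₗ[ℂ] Matrix n n ℂ) :
    (Matrix n n ℂ →ₗ[ℂ] Matrix m m ℂ) →ₗ[ℝ] ℝ where
  toFun φ := pairing φ ψ
  map_add' φ φ' := by simp [pairing_eq_re_trace, LinearMap.add_comp]
  map_smul' c φ := by simp [pairing_eq_re_trace, LinearMap.smul_comp]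

theorem pairingLeft_apply (ψ : Matrix m m ℂ →ₗ[ℂ] Matrix n n ℂ)
    (φ : Matrix n n ℂ →ₗ[ℂ] Matrix m m ℂ) : pairingLeft ψ φ = pairing φ ψ := rfl

/-- Every real linear functional on `Hom(B(H), B(K))` is a pairing. -/
theorem exists_pairing_eq (f : (Matrix n n ℂ →ₗ[ℂ] Matrix m m ℂ) →ₗ[ℝ] ℝ) :
    ∃ ψ : Matrix m m ℂ →ₗ[ℂ] Matrix n n ℂ, ∀ φ, f φ = pairing φ ψ := by
  let g : (Matrix n n ℂ →ₗ[ℂ] Matrix m m ℂ) →ₗ[ℂ] ℂ := Module.Dual.extendRCLike f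
  have hg : ∀ φ, (g φ).re = f φ := fun φ => Module.Dual.re_extendRCLike_apply (𝕜 := ℂ) f φ
  -- The entries of `ψ y` are the values of `g` on the rank-one maps `x ↦ xᵢⱼ y`, which span all
  -- maps.
  let ψ : Matrix m m ℂ →ₗ[ℂ] Matrix n n ℂ :=
    { toFun := fun y => of fun i j => g ((entryLinearMap ℂ ℂ i j).smulRight y)
      map_add' := fun y z => by
        ext i j
        simp only [of_apply, Matrix.add_apply, ← map_add]
        congr 1
        ext1 x
        simp
      map_smul' := fun c y => by
        ext i j
        simp only [of_apply, Matrix.smul_apply, ← map_smul, RingHom.id_apply]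
        congr 1
        ext1 x
        exact smul_comm _ _ _ }
  refine ⟨ψ, fun φ => ?_⟩
  rw [pairing_comm, ← hg, pairing, sFunctional]
  congr 1
  change g φ = ∑ i, ∑ j, g ((entryLinearMap ℂ ℂ i j).smulRight (φ (single i j 1)))
  have hφ : φ = ∑ i, ∑ j, (entryLinearMap ℂ ℂ i j).smulRight (φ (single i j 1)) := by
    refine linearMap_ext_single fun k l => ?_
    simp [LinearMap.sum_apply, single_apply, ite_and, ite_smul]
  refine (congrArg g hφ).trans ?_
  rw [map_sum]
  exact Finset.sum_congr rfl fun i _ => map_sum g _ _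

/-- The conjugate map `x ↦ φ(x*)*`. -/
def conjMap (φ : Matrix n n ℂ →ₗ[ℂ] Matrix m m ℂ) : Matrix n n ℂ →ₗ[ℂ] Matrix m m ℂ where
  toFun x := (φ xᴴ)ᴴ
  map_add' x y := by simp
  map_smul' c x := by simp

theorem conjMap_apply (φ : Matrix n n ℂ →ₗ[ℂ] Matrix m m ℂ) (x : Matrix n n ℂ) :
    conjMap φ x = (φ xᴴ)ᴴ := rfl

/-- Each term of the sum is conjugated and its indices swapped, which the real part does not see. -/
theorem pairing_conjMap (φ : Matrix n n ℂ →ₗ[ℂ] Matrix m m ℂ)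
    (ψ : Matrix m m ℂ →ₗ[ℂ] Matrix n n ℂ) : pairing (conjMap φ) (conjMap ψ) = pairing φ ψ := by
  simp only [pairing, sFunctional, LinearMap.comp_apply, conjMap_apply, conjTranspose_conjTranspose,
    conjTranspose_single, star_one, conjTranspose_apply, Complex.re_sum, RCLike.star_def,
    Complex.conj_re]
  exact Finset.sum_comm

variable {A B : FDCStarAlg}

theorem pairing_condExp {φ : A.Op →ₗ[ℂ] B.Op} (hφ : φ ∈ hermMaps A B) (ψ : B.Op →ₗ[ℂ] A.Op) :
    pairing φ (A.condExp ∘ₗ ψ ∘ₗ B.condExp) = pairing φ ψ := by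
  rw [← LinearMap.comp_assoc, pairing_comm, pairing_eq_re_trace, LinearMap.comp_assoc,
    condExp_comp_of_mem hφ, LinearMap.trace_comp_comm', ← LinearMap.comp_assoc,
    comp_condExp_of_mem hφ, ← pairing_eq_re_trace]

/-- Every real linear functional on `𝓛(A, B)` is the pairing with an element of `𝓛(B, A)`. -/
theorem exists_hermMaps_pairing_eq (f : (A.Op →ₗ[ℂ] B.Op) →ₗ[ℝ] ℝ) :
    ∃ Γ ∈ hermMaps B A, ∀ φ ∈ hermMaps A B, f φ = pairing φ Γ := by
  obtain ⟨ψ, hψ⟩ := exists_pairing_eq f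
  let χ := A.condExp ∘ₗ ψ ∘ₗ B.condExp
  have hA := A.isCompletelyPositive_condExp.map_conjTranspose
  have hB := B.isCompletelyPositive_condExp.map_conjTranspose
  have hχ : A.condExp ∘ₗ χ ∘ₗ B.condExp = χ := by
    have h : A.condExp ∘ₗ χ ∘ₗ B.condExp =
        (A.condExp ∘ₗ A.condExp) ∘ₗ ψ ∘ₗ (B.condExp ∘ₗ B.condExp) := rfl
    rw [h, A.condExp_comp_condExp, B.condExp_comp_condExp]
  have hχ' : A.condExp ∘ₗ conjMap χ ∘ₗ B.condExp = conjMap χ := by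
    ext1 x
    have h := LinearMap.congr_fun hχ xᴴ
    simp only [LinearMap.comp_apply] at h
    simp only [LinearMap.comp_apply, conjMap_apply]
    rw [hA, ← hB, h]
  -- The Hermitian part of `χ` has the same pairing with every Hermitian `φ`.
  refine ⟨(1 / 2 : ℝ) • (χ + conjMap χ), ⟨fun a => ?_, ?_⟩, fun φ hφ => ?_⟩
  · simp [conjMap_apply, add_comm]
  · ext1 x
    have h1 := LinearMap.congr_fun hχ x
    have h2 := LinearMap.congr_fun hχ' x
    simp only [LinearMap.comp_apply] at h1 h2
    simp only [LinearMap.comp_apply, LinearMap.smul_apply, LinearMap.add_apply]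
    rw [← Complex.coe_smul, map_smul, map_add, h1, h2, Complex.coe_smul]
  · have hφ' : conjMap φ = φ := by
      ext1 x
      rw [conjMap_apply, hφ.1, conjTranspose_conjTranspose]
    have h1 : pairing φ χ = f φ := (pairing_condExp hφ ψ).trans (hψ φ).symm
    have h2 : pairing φ (conjMap χ) = f φ := by
      conv_lhs => rw [← hφ']
      rw [pairing_conjMap, h1]
    rw [pairing_comm, ← pairingLeft_apply, map_smul, map_add, pairingLeft_apply, pairingLeft_apply,
      pairing_comm, h1, pairing_comm, h2, smul_eq_mul]
    ring

end Duality

/-! ### Topology of the space of maps, through coefficients. -/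

section Coefficients

open Matrix

set_option linter.unusedSectionVars false

variable {n m : Type} [Fintype n] [DecidableEq n] [Fintype m] [DecidableEq m]

/-- The identification of `Hom(B(H), B(K))` with its space of coefficients. -/
def coeffEquiv (n m : Type) [Fintype n] [DecidableEq n] :
    (Matrix n n ℂ →ₗ[ℂ] Matrix m m ℂ) ≃ₗ[ℝ] (n → n → m → m → ℂ) where
  toFun φ i j u v := φ (single i j 1) u v
  map_add' φ ψ := rfl
  map_smul' c φ := rfl
  invFun a :=
    { toFun := fun x => of fun u v => ∑ i, ∑ j, x i j * a i j u v
      map_add' := fun x y => by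
        ext u v
        simp [add_mul, Finset.sum_add_distrib]
      map_smul' := fun c x => by
        ext u v
        simp [Finset.mul_sum, mul_assoc] }
  left_inv φ := by
    ext1 x
    ext u v
    exact (linearMap_apply_eq_sum φ x u v).symm
  right_inv a := by
    funext i j u v
    simp [single_apply, ite_and]

theorem coeffEquiv_apply (φ : Matrix n n ℂ →ₗ[ℂ] Matrix m m ℂ) (i j : n) (u v : m) :
    coeffEquiv n m φ i j u v = φ (single i j 1) u v := rfl

theorem coeffEquiv_symm_apply (a : n → n → m → m → ℂ) (x : Matrix n n ℂ) (u v : m) :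
    (coeffEquiv n m).symm a x u v = ∑ i, ∑ j, x i j * a i j u v := rfl

theorem continuous_coeffEquiv_symm_apply (x : Matrix n n ℂ) :
    Continuous fun a => (coeffEquiv n m).symm a x := by
  refine continuous_matrix fun u v => ?_
  simp only [coeffEquiv_symm_apply]
  fun_prop

theorem isClosed_posSemidef : IsClosed {M : Matrix n n ℂ | M.PosSemidef} := by
  simp only [posSemidef_iff_dotProduct_mulVec, Set.ofPred_and, Set.ofPred_forall]
  refine IsClosed.inter (isClosed_eq (by fun_prop) (by fun_prop)) (isClosed_iInter fun x => ?_)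
  exact isClosed_le continuous_const (by fun_prop)

/-- On completely positive maps, a real linear functional is dominated by a multiple of
`φ ↦ Tr φ(1)`. -/
theorem exists_abs_le_mul_trace (f : (Matrix n n ℂ →ₗ[ℂ] Matrix m m ℂ) →ₗ[ℝ] ℝ) :
    ∃ C : ℝ, 0 ≤ C ∧ ∀ φ, IsCompletelyPositive φ → |f φ| ≤ C * (φ 1).trace.re := by
  let g := LinearMap.toContinuousLinearMap (f ∘ₗ (coeffEquiv n m).symm.toLinearMap)
  refine ⟨‖g‖, norm_nonneg _, fun φ hφ => ?_⟩
  have h0 : 0 ≤ (φ 1).trace.re := by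
    have h1 := (isCompletelyPositive_iff φ).1 hφ
    obtain ⟨κ, _, K, rfl⟩ := h1
    exact (Complex.le_def.1 (krausMap_posSemidef K 1 PosSemidef.one).trace_nonneg).1
  have hg : f φ = g (coeffEquiv n m φ) := by simp [g]
  rw [hg, ← Real.norm_eq_abs]
  refine (g.le_opNorm _).trans (mul_le_mul_of_nonneg_left ?_ (norm_nonneg _))
  refine (pi_norm_le_iff_of_nonneg h0).2 fun i => (pi_norm_le_iff_of_nonneg h0).2 fun j =>
    (pi_norm_le_iff_of_nonneg h0).2 fun u => (pi_norm_le_iff_of_nonneg h0).2 fun v => ?_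
  exact hφ.norm_apply_single_le i j u v

variable {A B : FDCStarAlg}

theorem isClosed_cpCone : IsClosed {a | (coeffEquiv A.ι B.ι).symm a ∈ cpCone A B} := by
  have hcond : Continuous B.condExp :=
    LinearMap.continuous_of_finiteDimensional (E := Matrix B.ι B.ι ℂ) (F' := Matrix B.ι B.ι ℂ) _
  simp only [mem_cpCone_iff, Set.ofPred_and]
  refine IsClosed.inter ?_ ?_
  · simp only [IsCompletelyPositive, IsPositiveMap, Set.ofPred_forall]
    refine isClosed_iInter fun r => isClosed_iInter fun X => isClosed_iInter fun _ => ?_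
    refine isClosed_posSemidef.preimage (continuous_matrix fun u v => ?_)
    have h : ∀ x u v, Continuous fun a => (coeffEquiv A.ι B.ι).symm a x u v := fun x u v =>
      (continuous_coeffEquiv_symm_apply x).matrix_elem u v
    simp only [mapTensor, LinearMap.coe_mk, AddHom.coe_mk, Matrix.sum_apply, Matrix.smul_apply,
      kroneckerMap_apply]
    exact continuous_finsetSum _ fun i _ => continuous_finsetSum _ fun j _ =>
      continuous_finsetSum _ fun k _ => continuous_finsetSum _ fun l _ =>
      ((h (single i j 1) u.1 v.1).mul_const (LinearMap.id (R := ℂ) (single k l 1) u.2 v.2)).const_smul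
        (X (i, k) (j, l))
  · simp only [LinearMap.ext_iff, Set.ofPred_forall]
    exact isClosed_iInter fun x => isClosed_eq
      (hcond.comp (continuous_coeffEquiv_symm_apply _)) (continuous_coeffEquiv_symm_apply _)

theorem trace_apply_one_of_mem_channels {φ : A.Op →ₗ[ℂ] B.Op} (hφ : φ ∈ channels A B) :
    (φ 1).trace.re = Fintype.card A.ι := by
  rw [hφ.2, trace_one, Complex.natCast_re]

/-- Closedness is checked input by input; boundedness holds because each coefficient is dominated by
`Tr φ(1)`, which is the dimension of the input space. -/
theorem isCompact_channels : IsCompact {a | (coeffEquiv A.ι B.ι).symm a ∈ channels A B} := by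
  refine Metric.isCompact_of_isClosed_isBounded ?_ ?_
  · have h : IsClosed {a | ∀ x, ((coeffEquiv A.ι B.ι).symm a x).trace = x.trace} := by
      simp only [Set.ofPred_forall]
      exact isClosed_iInter fun x => isClosed_eq
        (continuous_coeffEquiv_symm_apply _).matrix_trace continuous_const
    exact isClosed_cpCone.inter h
  · refine (Metric.isBounded_closedBall (x := 0) (r := Fintype.card A.ι)).subset fun a ha => ?_
    have h0 : (0 : ℝ) ≤ Fintype.card A.ι := by positivity
    rw [mem_closedBall_zero_iff]
    refine (pi_norm_le_iff_of_nonneg h0).2 fun i => (pi_norm_le_iff_of_nonneg h0).2 fun j =>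
      (pi_norm_le_iff_of_nonneg h0).2 fun u => (pi_norm_le_iff_of_nonneg h0).2 fun v => ?_
    have := ha.1.2.norm_apply_single_le i j u v
    rwa [← coeffEquiv_apply, LinearEquiv.apply_symm_apply, trace_apply_one_of_mem_channels ha]
      at this

end Coefficients

/-! ### The dual diamond norm, separation, and the randomization criterion. -/

section Norm

theorem comp_real_smul {V W X : Type*} [AddCommGroup V] [Module ℂ V] [AddCommGroup W] [Module ℂ W]
    [AddCommGroup X] [Module ℂ X] (c : ℝ) (f : W →ₗ[ℂ] X) (g : V →ₗ[ℂ] W) :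
    f ∘ₗ (c • g) = c • (f ∘ₗ g) := by
  ext1 x
  simp only [LinearMap.comp_apply, LinearMap.smul_apply]
  rw [← Complex.coe_smul, map_smul, Complex.coe_smul]

variable {A B : FDCStarAlg}

theorem channels_subset_sectionBall : channels A B ⊆ sectionBall (cpCone A B) (channels A B) :=
  fun c hc => ⟨c, hc, cpCone_add hc.1 hc.1, by rw [sub_self]; exact zero_mem_cpCone⟩

/-- Guarantees that the `sSup` in the norm is a true supremum. Writing `2ξ = (b + ξ) - (b - ξ)` as a
difference of CP maps bounds the pairing by a multiple of `Tr b(1)`. -/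
theorem bddAbove_pairing_sectionBall (Γ : B.Op →ₗ[ℂ] A.Op) :
    BddAbove {r | ∃ ξ ∈ sectionBall (cpCone A B) (channels A B), r = pairing ξ Γ} := by
  obtain ⟨C, -, hC⟩ := exists_abs_le_mul_trace (pairingLeft Γ)
  refine ⟨C * Fintype.card A.ι, ?_⟩
  rintro _ ⟨ξ, ⟨b, hb, h1, h2⟩, rfl⟩
  have h3 := (abs_le.1 (hC _ h1.2)).2
  have h4 := (abs_le.1 (hC _ h2.2)).1
  simp only [map_add, map_sub, pairingLeft_apply, LinearMap.add_apply, LinearMap.sub_apply,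
    Matrix.trace_add, Matrix.trace_sub, Complex.add_re, Complex.sub_re,
    trace_apply_one_of_mem_channels hb] at h3 h4
  linarith

theorem pairing_le_dualDiamondNorm (Γ : B.Op →ₗ[ℂ] A.Op) {c : A.Op →ₗ[ℂ] B.Op}
    (hc : c ∈ channels A B) : pairing c Γ ≤ dualDiamondNorm B A Γ :=
  le_csSup (bddAbove_pairing_sectionBall Γ) ⟨c, channels_subset_sectionBall hc, rfl⟩

theorem continuous_pairing_coeffEquiv_symm (Γ : B.Op →ₗ[ℂ] A.Op) :
    Continuous fun a => pairing ((coeffEquiv A.ι B.ι).symm a) Γ :=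
  LinearMap.continuous_of_finiteDimensional
    (pairingLeft Γ ∘ₗ (coeffEquiv A.ι B.ι).symm.toLinearMap)

/-- On the dual cone, the norm is the maximum of the pairing over channels. -/
theorem exists_dualDiamondNorm_le_pairing (hne : (channels A B).Nonempty) {Γ : B.Op →ₗ[ℂ] A.Op}
    (hΓ : Γ ∈ cpDualCone B A) : ∃ c ∈ channels A B, dualDiamondNorm B A Γ ≤ pairing c Γ := by
  obtain ⟨c₀, hc₀⟩ := hne
  obtain ⟨a, ha, hmax⟩ := isCompact_channels.exists_isMaxOn
    ⟨coeffEquiv A.ι B.ι c₀, by simpa using hc₀⟩ (continuous_pairing_coeffEquiv_symm Γ).continuousOn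
  refine ⟨_, ha, csSup_le ⟨_, c₀, channels_subset_sectionBall hc₀, rfl⟩ ?_⟩
  rintro _ ⟨ξ, ⟨b, hb, -, h2⟩, rfl⟩
  -- Since `b - ξ` is CP and `Γ` is in the dual cone, `ξ` pairs with `Γ` no higher than the channel
  -- `b`.
  have h3 := hΓ.2 _ h2
  have h4 : pairing b Γ ≤ pairing ((coeffEquiv A.ι B.ι).symm a) Γ := by
    have := hmax (a := coeffEquiv A.ι B.ι b) (by simpa using hb)
    simpa using this
  rw [← pairingLeft_apply, map_sub, pairingLeft_apply, pairingLeft_apply] at h3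
  linarith

/-- A compact convex set of Hermitian maps that cannot be separated from the cone of completely
positive maps meets it. -/
theorem exists_mem_cpCone {K : Set (A.Op →ₗ[ℂ] B.Op)} (hK : K ⊆ hermMaps A B) (hconv : Convex ℝ K)
    (hcomp : IsCompact (coeffEquiv A.ι B.ι '' K))
    (h : ∀ Γ ∈ cpDualCone B A, ∃ κ ∈ K, 0 ≤ pairing κ Γ) : ∃ κ ∈ K, κ ∈ cpCone A B := by
  by_contra! hdisj
  have hc : Convex ℝ {a | (coeffEquiv A.ι B.ι).symm a ∈ cpCone A B} :=
    convex_cpCone.linear_preimage (coeffEquiv A.ι B.ι).symm.toLinearMap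
  obtain ⟨f, u, v, h1, h2, h3⟩ := geometric_hahn_banach_compact_closed
    (hconv.linear_image (coeffEquiv A.ι B.ι).toLinearMap) hcomp hc isClosed_cpCone
    (Set.disjoint_left.2 (by
      rintro _ ⟨κ, hκ, rfl⟩ h
      exact hdisj κ hκ (by simpa using h)))
  have hneg : v < 0 := by simpa using h3 0 (by simpa using zero_mem_cpCone)
  let F : (A.Op →ₗ[ℂ] B.Op) →ₗ[ℝ] ℝ := f.toLinearMap ∘ₗ (coeffEquiv A.ι B.ι).toLinearMap
  obtain ⟨Γ, hΓ, hF⟩ := exists_hermMaps_pairing_eq F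
  have hdual : Γ ∈ cpDualCone B A := by
    refine ⟨hΓ, fun φ hφ => ?_⟩
    rw [← hF φ hφ.1]
    by_contra! hlt
    -- A negative value of `F` at `φ` could be rescaled within the cone to equal `v` exactly,
    -- against the strict bound `v < F`.
    have hs : 0 ≤ v / F φ := (div_pos_of_neg_of_neg hneg hlt).le
    have h4 : v < F ((v / F φ) • φ) :=
      h3 (coeffEquiv A.ι B.ι ((v / F φ) • φ)) (by simpa using cpCone_smul hφ hs)
    rw [map_smul, smul_eq_mul, div_mul_cancel₀ _ hlt.ne] at h4
    exact lt_irrefl _ h4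
  obtain ⟨κ, hκ, h5⟩ := h Γ hdual
  rw [← hF κ (hK hκ)] at h5
  have h6 : F κ < u := h1 _ ⟨κ, hκ, rfl⟩
  linarith

variable {B' : FDCStarAlg}

/-- The randomization criterion: if `Ψ` is deficient with respect to `Φ` for the decision algebra
`B`, then `Φ ≤ α ∘ Ψ + ε c` for some channels `α` and `c`. -/
theorem DeficientFor.exists_channels {ε : ℝ} {Ψ : A.Op →ₗ[ℂ] B'.Op} {Φ : A.Op →ₗ[ℂ] B.Op}
    (hε : 0 ≤ ε) (hΦ : Φ ∈ channels A B) (hΨ : Ψ ∈ channels A B')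
    (h : DeficientFor ε B Ψ Φ) :
    ∃ α ∈ channels B' B, ∃ c ∈ channels A B, α ∘ₗ Ψ + ε • c - Φ ∈ cpCone A B := by
  let K : Set (A.Op →ₗ[ℂ] B.Op) :=
    {κ | ∃ α ∈ channels B' B, ∃ c ∈ channels A B, α ∘ₗ Ψ + ε • c - Φ = κ}
  suffices hK : ∃ κ ∈ K, κ ∈ cpCone A B by
    obtain ⟨_, ⟨α, hα, c, hc, rfl⟩, hκ⟩ := hK
    exact ⟨α, hα, c, hc, hκ⟩
  refine exists_mem_cpCone ?_ ?_ ?_ ?_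
  · rintro _ ⟨α, hα, c, hc, rfl⟩
    exact sub_mem (add_mem (channels_comp hα hΨ).1.1 (Submodule.smul_mem _ _ hc.1.1)) hΦ.1.1
  · rintro _ ⟨α, hα, c, hc, rfl⟩ _ ⟨α', hα', c', hc', rfl⟩ a b ha hb hab
    refine ⟨_, convex_channels hα hα' ha hb hab, _, convex_channels hc hc' ha hb hab, ?_⟩
    have hΦ' : Φ = a • Φ + b • Φ := by rw [← add_smul, hab, one_smul]
    conv_lhs => rw [hΦ']
    simp only [LinearMap.add_comp, LinearMap.smul_comp, smul_add, smul_sub, smul_comm ε]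
    abel
  -- In coordinates `K` is a continuous image of a product of two compact sets of channels.
  · let G : (B'.ι → B'.ι → B.ι → B.ι → ℂ) × (A.ι → A.ι → B.ι → B.ι → ℂ) →
        A.ι → A.ι → B.ι → B.ι → ℂ := fun p =>
      coeffEquiv A.ι B.ι ((coeffEquiv B'.ι B.ι).symm p.1 ∘ₗ Ψ +
        ε • (coeffEquiv A.ι B.ι).symm p.2 - Φ)
    have hG : Continuous G := by
      refine continuous_pi fun i => continuous_pi fun j => continuous_pi fun u =>
        continuous_pi fun v => ?_
      have h1 : Continuous fun p : (B'.ι → B'.ι → B.ι → B.ι → ℂ) × (A.ι → A.ι → B.ι → B.ι → ℂ) =>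
          (coeffEquiv B'.ι B.ι).symm p.1 (Ψ (Matrix.single i j 1)) u v :=
        ((continuous_coeffEquiv_symm_apply _).comp continuous_fst).matrix_elem u v
      have h2 : Continuous fun p : (B'.ι → B'.ι → B.ι → B.ι → ℂ) × (A.ι → A.ι → B.ι → B.ι → ℂ) =>
          (coeffEquiv A.ι B.ι).symm p.2 (Matrix.single i j 1) u v :=
        ((continuous_coeffEquiv_symm_apply _).comp continuous_snd).matrix_elem u v
      exact (h1.add (h2.const_smul ε)).sub continuous_const
    have hset : coeffEquiv A.ι B.ι '' K =
        G '' ({a | (coeffEquiv B'.ι B.ι).symm a ∈ channels B' B} ×ˢ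
          {a | (coeffEquiv A.ι B.ι).symm a ∈ channels A B}) := by
      ext x
      constructor
      · rintro ⟨_, ⟨α, hα, c, hc, rfl⟩, rfl⟩
        exact ⟨(coeffEquiv B'.ι B.ι α, coeffEquiv A.ι B.ι c), ⟨by simpa using hα, by simpa using hc⟩,
          by simp [G]⟩
      · rintro ⟨⟨a, b⟩, ⟨ha, hb⟩, rfl⟩
        exact ⟨_, ⟨_, ha, _, hb, rfl⟩, rfl⟩
    rw [hset]
    exact (isCompact_channels.prod isCompact_channels).image hG
  · intro Γ hΓ
    -- `B.condExp` plays the identity channel of `B`; `c` attains the norm of `Γ`, turning the error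
    -- term into `ε ⟨c, Γ⟩`.
    obtain ⟨α, hα, h1⟩ := h Γ hΓ B.condExp condExp_mem_channels
    obtain ⟨c, hc, h2⟩ := exists_dualDiamondNorm_le_pairing ⟨Φ, hΦ⟩ hΓ
    refine ⟨_, ⟨α, hα, c, hc, rfl⟩, ?_⟩
    rw [condExp_comp_of_mem hΦ.1.1] at h1
    have h3 := mul_le_mul_of_nonneg_left h2 hε
    rw [← pairingLeft_apply, map_sub, map_add, map_smul, smul_eq_mul]
    simp only [pairingLeft_apply]
    linarith

/-- Tensoring `Φ ≤ α ∘ Ψ + ε c` with `ξ` and applying `β` keeps the order; the error term is `ε`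
times the pairing of a channel with `Γ`, hence at most `ε` times the norm. -/
theorem deficient_tensorMap {E F : FDCStarAlg} {ε : ℝ} {Ψ : A.Op →ₗ[ℂ] B'.Op}
    {Φ : A.Op →ₗ[ℂ] B.Op} {ξ : E.Op →ₗ[ℂ] F.Op} (hε : 0 ≤ ε) (hΦ : Φ ∈ channels A B)
    (hΨ : Ψ ∈ channels A B') (hξ : ξ ∈ channels E F) (h : Deficient ε Ψ Φ) :
    Deficient ε (tensorMap Ψ ξ) (tensorMap Φ ξ) := by
  intro D Γ hΓ β hβ
  obtain ⟨α, hα, c, hc, hcp⟩ := (h B).exists_channels hε hΦ hΨ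
  refine ⟨β ∘ₗ tensorMap α F.condExp,
    channels_comp hβ (channels_tensorMap hα condExp_mem_channels), ?_⟩
  have h1 := pairing_le_dualDiamondNorm Γ (channels_comp hβ (channels_tensorMap hc hξ))
  have h2 := hΓ.2 _ (cpCone_comp hβ.1 (cpCone_tensorMap hcp hξ.1))
  rw [tensorMap_sub, tensorMap_add, tensorMap_smul, LinearMap.comp_sub, LinearMap.comp_add,
    comp_real_smul, ← pairingLeft_apply, map_sub, map_add, map_smul, smul_eq_mul] at h2
  have h3 : (β ∘ₗ tensorMap α F.condExp) ∘ₗ tensorMap Ψ ξ = β ∘ₗ tensorMap (α ∘ₗ Ψ) ξ := by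
    rw [LinearMap.comp_assoc, ← tensorMap_comp, condExp_comp_of_mem hξ.1.1]
  rw [h3]
  simp only [pairingLeft_apply] at h2
  have h4 := mul_le_mul_of_nonneg_left h1 hε
  linarith

end Norm

/-! ### Unitary bases, teleportation and the Bell measurement. -/

section Teleportation

open Matrix

/-- A family of unitaries that is orthogonal and complete for the Hilbert-Schmidt inner product. -/
structure IsUnitaryBasis {d s : Type} [Fintype d] [DecidableEq d] [Fintype s]
    (V : s → Matrix d d ℂ) : Prop where
  unitary : ∀ t, V t * (V t)ᴴ = 1
  complete : ∀ p q i j, ∑ t, V t p i * star (V t q j) =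
    if p = q ∧ i = j then (Fintype.card d : ℂ) else 0
  card_eq : Fintype.card s = Fintype.card d ^ 2

/-- The clock and shift unitaries form a unitary basis. -/
theorem exists_isUnitaryBasis (k : ℕ) [NeZero k] :
    ∃ V : Fin (k ^ 2) → Matrix (Fin k) (Fin k) ℂ, IsUnitaryBasis V := by
  let e : Fin k ≃ ZMod k := (ZMod.finEquiv k).toEquiv
  let χ : AddChar (ZMod k) ℂ := ZMod.stdAddChar
  have hχ : ∀ x, star (χ x) = χ (-x) := fun x => (AddChar.map_neg_eq_conj χ x).symm
  have hχ' : ∀ c x y, χ (c * x) * χ (-(c * y)) = χ (c * (x - y)) := fun c x y => by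
    rw [← AddChar.map_add_eq_mul]
    congr 1
    ring
  obtain ⟨g⟩ : Nonempty (Fin (k ^ 2) ≃ ZMod k × ZMod k) :=
    Fintype.card_eq.1 (by simp [ZMod.card, sq])
  -- For `g t = (a, b)` this is the shift by `a` after the clock operator `b`. Completeness is
  -- orthogonality of the characters of `ZMod k`.
  refine ⟨fun t => of fun p i => if e p = e i + (g t).1 then χ ((g t).2 * e i) else 0,
    fun t => ?_, fun p q i j => ?_, by simp⟩
  · ext p q
    rw [mul_apply, ← e.symm.sum_comp]
    simp only [of_apply, conjTranspose_apply, Equiv.apply_symm_apply, apply_ite star, star_zero, hχ]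
    rw [Finset.sum_eq_single (e p - (g t).1)]
    · simp [hχ', one_apply, eq_comm]
    · intro x _ hx
      have h : e p ≠ x + (g t).1 := fun h => hx (sub_eq_of_eq_add h).symm
      simp [h]
    · simp
  · rw [← g.symm.sum_comp, Fintype.sum_prod_type]
    simp only [of_apply, Equiv.apply_symm_apply, apply_ite star, star_zero, hχ, ite_mul, zero_mul,
      mul_ite, mul_zero, hχ']
    have h1 := AddChar.sum_mulShift (ψ := χ) (e i - e j) (ZMod.isPrimitive_stdAddChar k)
    rw [Finset.sum_eq_single (e p - e i)]
    · by_cases hij : i = j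
      · subst hij
        by_cases hpq : p = q
        · simp [hpq, ZMod.card]
        · simp [hpq, Ne.symm hpq]
      · rw [if_neg (sub_ne_zero.2 (e.injective.ne hij)), Nat.cast_zero] at h1
        simp [hij, h1]
    · intro a _ ha
      have h : e p ≠ e i + a := fun h => ha (by rw [h]; ring)
      simp [h]
    · simp

variable {A B D S : FDCStarAlg}

theorem FDCStarAlg.kron_apply (a : A.Op) (b : D.Op) (x y : (A.tensor D).ι) :
    kron a b x y = a x.1 y.1 * b x.2 y.2 := rfl

/-- The matrix unit pins the second indices to `i` and `j`, leaving a form in `b` alone. -/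
theorem FDCStarAlg.sum_mul_kron_single_mul (f g : A.ι × D.ι → ℂ) (b : A.Op) (i j : D.ι) :
    ∑ x : (A.tensor D).ι, ∑ y : (A.tensor D).ι, f x * kron b (single i j 1) x y * g y =
      ∑ p, ∑ q, f (p, i) * b p q * g (q, j) := by
  have h : ∀ p i' q j', kron b (single i j (1 : ℂ)) ((p, i') : (A.tensor D).ι) (q, j') =
      if i' = i then if j' = j then b p q else 0 else 0 := by
    intro p i' q j'
    refine (FDCStarAlg.kron_apply b _ (p, i') (q, j')).trans ?_
    rw [single_apply, mul_ite, mul_one, mul_zero, ite_and]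
    simp only [eq_comm]
  refine (Fintype.sum_prod_type (α₁ := A.ι) (α₂ := D.ι) _).trans ?_
  refine Finset.sum_congr rfl fun p _ => ?_
  rw [Finset.sum_eq_single i]
  · refine (Fintype.sum_prod_type (α₁ := A.ι) (α₂ := D.ι) _).trans ?_
    refine Finset.sum_congr rfl fun q _ => ?_
    rw [Finset.sum_eq_single j]
    · rw [h, if_pos rfl, if_pos rfl]
    · intro j' _ hj
      rw [h, if_pos rfl, if_neg hj, mul_zero, zero_mul]
    · simp
  · rintro i' _ hi
    refine Finset.sum_eq_zero ?_
    rintro ⟨q, j'⟩ _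
    rw [h, if_neg hi, mul_zero, zero_mul]
  · simp

/-- The teleportation of a map `β : A ⊗ D → S`: a maximally entangled state on `D ⊗ D` is shared,
`β` is applied to the input and the first half, and the unitary `V s` indexed by the outcome `s` is
applied to the second half. -/
noncomputable def teleport (V : S.ι → D.Op) :
    ((A.tensor D).Op →ₗ[ℂ] S.Op) →ₗ[ℝ] (A.Op →ₗ[ℂ] D.Op) where
  toFun β :=
    -- The prefactor normalises the entangled state. The inner matrix is the unnormalised state left
    -- on the second half at outcome `s`; only diagonal outputs of `β` enter.
    { toFun := fun b => (Fintype.card D.ι : ℝ)⁻¹ •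
        ∑ s, V s * (of fun i j => β (FDCStarAlg.kron b (single i j 1)) s s) * (V s)ᴴ
      map_add' := fun b b' => by
        rw [← smul_add, ← Finset.sum_add_distrib]
        congr 1
        refine Finset.sum_congr rfl fun s _ => ?_
        rw [← Matrix.add_mul, ← Matrix.mul_add]
        congr 2
        ext i j
        simp [FDCStarAlg.kron_add_left]
      map_smul' := fun c b => by
        rw [RingHom.id_apply, smul_comm c, Finset.smul_sum (r := c)]
        congr 1
        refine Finset.sum_congr rfl fun s _ => ?_
        rw [← Matrix.smul_mul, ← Matrix.mul_smul]
        congr 2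
        ext i j
        have : FDCStarAlg.kron (c • b) (single i j (1 : ℂ)) =
            c • FDCStarAlg.kron (A := A) (B := D) b (single i j 1) := by
          ext x y
          exact mul_assoc c (b x.1 y.1) _
        simp [this] }
  map_add' β β' := by
    ext1 b
    simp only [LinearMap.coe_mk, AddHom.coe_mk, LinearMap.add_apply]
    rw [← smul_add, ← Finset.sum_add_distrib]
    congr 1
    refine Finset.sum_congr rfl fun s _ => ?_
    rw [← Matrix.add_mul, ← Matrix.mul_add]
    rfl
  map_smul' c β := by
    ext1 b
    simp only [LinearMap.coe_mk, AddHom.coe_mk, LinearMap.smul_apply, RingHom.id_apply]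
    rw [smul_comm c, Finset.smul_sum (r := c)]
    congr 1
    refine Finset.sum_congr rfl fun s _ => ?_
    rw [← Matrix.smul_mul, ← Matrix.mul_smul]
    rfl

theorem teleport_apply (V : S.ι → D.Op) (β : (A.tensor D).Op →ₗ[ℂ] S.Op) (b : A.Op) :
    teleport V β b = (Fintype.card D.ι : ℝ)⁻¹ •
      ∑ s, V s * (of fun i j => β (FDCStarAlg.kron b (single i j 1)) s s) * (V s)ᴴ := rfl

/-- Processing the first factor does not touch the shared entangled state. -/
theorem teleport_comp_tensorMap (V : S.ι → D.Op) (β : (B.tensor D).Op →ₗ[ℂ] S.Op)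
    (φ : A.Op →ₗ[ℂ] B.Op) :
    teleport V (β ∘ₗ tensorMap φ LinearMap.id) = teleport V β ∘ₗ φ := by
  ext1 b
  simp only [LinearMap.comp_apply, teleport_apply, tensorMap_kron, LinearMap.id_apply]

/-- Row `s` of each Kraus operator of `β`, reshaped into a map from `A` to `D` and multiplied by `V
s`, is a Kraus operator of the result up to normalisation. -/
theorem teleport_isCompletelyPositive (V : S.ι → D.Op) {β : (A.tensor D).Op →ₗ[ℂ] S.Op}
    (hβ : IsCompletelyPositive β) : IsCompletelyPositive (teleport V β) := by
  obtain ⟨κ, _, K, rfl⟩ := (isCompletelyPositive_iff _).1 hβ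
  let L : S.ι → κ → Matrix D.ι A.ι ℂ := fun s r => of fun i p => K r s (p, i)
  have h : teleport V (krausMap K) = (Fintype.card D.ι : ℝ)⁻¹ •
      krausMap fun x : S.ι × κ => V x.1 * L x.1 x.2 := by
    ext1 b
    rw [teleport_apply, LinearMap.smul_apply, krausMap_apply, Fintype.sum_prod_type]
    congr 1
    refine Finset.sum_congr rfl fun s _ => ?_
    have h1 : (of fun i j => krausMap K (FDCStarAlg.kron b (single i j 1)) s s : D.Op) =
        krausMap (L s) b := by
      ext i j
      rw [of_apply, krausMap_apply_apply, krausMap_apply_apply]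
      refine Finset.sum_congr rfl fun r _ => ?_
      exact FDCStarAlg.sum_mul_kron_single_mul (K r s) (fun y => star (K r s y)) b i j
    rw [h1, krausMap_apply, Matrix.mul_sum, Matrix.sum_mul]
    simp only [conjTranspose_mul, Matrix.mul_assoc]
  rw [h]
  exact (isCompletelyPositive_krausMap _).smul (by positivity)

theorem teleport_mem_cpCone (hD : D.condExp = LinearMap.id) (V : S.ι → D.Op)
    {β : (A.tensor D).Op →ₗ[ℂ] S.Op} (hβ : β ∈ cpCone (A.tensor D) S) :
    teleport V β ∈ cpCone A D := by
  refine mem_cpCone_of_comp_eq (teleport_isCompletelyPositive V hβ.2) (by rw [hD]; rfl) ?_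
  rw [← teleport_comp_tensorMap, ← hD, ← FDCStarAlg.condExp_tensor, comp_condExp_of_mem hβ.1]

theorem FDCStarAlg.sum_kron_single (b : A.Op) :
    ∑ i, kron b (single i i (1 : ℂ) : D.Op) = kron b 1 := by
  ext x y
  simp only [Matrix.sum_apply]
  change ∑ i, b x.1 y.1 * (single i i (1 : ℂ) : D.Op) x.2 y.2 = b x.1 y.1 * (1 : D.Op) x.2 y.2
  rw [← Finset.mul_sum]
  simp [single_apply, one_apply, ite_and]

/-- Unitaries drop out of the trace, leaving `Tr β(b ⊗ 1) = Tr b · dim D`, which cancels the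
prefactor. -/
theorem teleport_mem_channels (hD : D.condExp = LinearMap.id) {V : S.ι → D.Op}
    (hV : IsUnitaryBasis V) {β : (A.tensor D).Op →ₗ[ℂ] S.Op} (hβ : β ∈ channels (A.tensor D) S) :
    teleport V β ∈ channels A D := by
  refine ⟨teleport_mem_cpCone hD V hβ.1, fun b => ?_⟩
  have h0 : (Fintype.card D.ι : ℂ) ≠ 0 := by exact_mod_cast Fintype.card_ne_zero
  have h1 : ∀ s, (V s * (of fun i j => β (FDCStarAlg.kron b (single i j 1)) s s) * (V s)ᴴ).trace =
      ∑ i, β (FDCStarAlg.kron b (single i i 1)) s s := by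
    intro s
    rw [trace_mul_comm, ← Matrix.mul_assoc, mul_eq_one_comm.1 (hV.unitary s), Matrix.one_mul]
    rfl
  have h2 : ∑ s, ∑ i, β (FDCStarAlg.kron b (single i i 1)) s s = b.trace * Fintype.card D.ι := by
    have h3 := hβ.2 (FDCStarAlg.kron b (1 : D.Op))
    rw [FDCStarAlg.trace_kron, trace_one] at h3
    rw [← h3, ← FDCStarAlg.sum_kron_single, map_sum]
    simp [trace, Matrix.sum_apply]
  rw [teleport_apply, trace_smul, trace_sum, Finset.sum_congr rfl fun s _ => h1 s, h2,
    Complex.real_smul, Complex.ofReal_inv, Complex.ofReal_natCast]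
  field_simp

/-- The measurement in the basis of maximally entangled vectors defined by the `V s`. -/
noncomputable def bellMeasurement (V : S.ι → D.Op) : (D.tensor D).Op →ₗ[ℂ] S.Op :=
  (Fintype.card D.ι : ℝ)⁻¹ •
    krausMap fun s => of fun s' x => if s' = s then star (V s x.1 x.2) else 0

theorem bellMeasurement_apply (V : S.ι → D.Op) (X : (D.tensor D).Op) (u v : S.ι) :
    bellMeasurement V X u v = if u = v then (Fintype.card D.ι : ℂ)⁻¹ *
      ∑ x : (D.tensor D).ι, ∑ y : (D.tensor D).ι, star (V u x.1 x.2) * X x y * V u y.1 y.2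
      else 0 := by
  rw [bellMeasurement, LinearMap.smul_apply, Matrix.smul_apply, krausMap_apply_apply,
    Complex.real_smul, Complex.ofReal_inv, Complex.ofReal_natCast]
  split_ifs with h
  · subst h
    congr 1
    rw [Finset.sum_eq_single u]
    · simp
    · intro s _ hs
      simp [hs.symm]
    · simp
  · rw [Finset.sum_eq_zero, mul_zero]
    intro s _
    refine Finset.sum_eq_zero fun x _ => Finset.sum_eq_zero fun y _ => ?_
    by_cases h1 : u = s
    · have h2 : v ≠ s := fun h2 => h (h1.trans h2.symm)
      simp [h2]
    · simp [h1]

/-- The output is diagonal, hence in `S` whatever its blocks; trace preservation is completeness of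
`V`. -/
theorem bellMeasurement_mem_channels (hD : D.condExp = LinearMap.id) {V : S.ι → D.Op}
    (hV : IsUnitaryBasis V) : bellMeasurement V ∈ channels (D.tensor D) S := by
  have h0 : (Fintype.card D.ι : ℂ) ≠ 0 := by exact_mod_cast Fintype.card_ne_zero
  refine ⟨mem_cpCone_of_comp_eq ((isCompletelyPositive_krausMap _).smul (by positivity)) ?_ ?_,
    fun X => ?_⟩
  · ext1 X
    ext u v
    rw [LinearMap.comp_apply, FDCStarAlg.condExp_apply, bellMeasurement_apply]
    split_ifs with h1 h2 h2
    · rfl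
    · rfl
    · exact absurd (congrArg _ h2) h1
    · rfl
  · have h : (D.tensor D).condExp = LinearMap.id := by
      rw [FDCStarAlg.condExp_tensor, hD]
      exact FDCStarAlg.linearMap_ext_kron fun a b => tensorMap_kron _ _ _ _
    rw [h]
    rfl
  · simp only [trace, diag_apply, bellMeasurement_apply, if_true]
    rw [← Finset.mul_sum, Finset.sum_comm]
    have h : ∀ x : (D.tensor D).ι, ∑ s, ∑ y : (D.tensor D).ι,
        star (V s x.1 x.2) * X x y * V s y.1 y.2 = Fintype.card D.ι * X x x := by
      intro x
      rw [Finset.sum_comm]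
      have h1 : ∀ y : (D.tensor D).ι, ∑ s, star (V s x.1 x.2) * X x y * V s y.1 y.2 =
          if y = x then Fintype.card D.ι * X x y else 0 := by
        intro y
        have h2 : (y = x) = (y.1 = x.1 ∧ y.2 = x.2) := propext Prod.ext_iff
        have h3 := hV.complete y.1 x.1 y.2 x.2
        rw [Finset.sum_congr rfl fun s _ => show star (V s x.1 x.2) * X x y * V s y.1 y.2 =
          (V s y.1 y.2 * star (V s x.1 x.2)) * X x y by ring, ← Finset.sum_mul, h3]
        simp only [h2, ite_mul, zero_mul]
      rw [Finset.sum_congr rfl fun y _ => h1 y, Finset.sum_ite_eq']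
      simp
    rw [Finset.sum_congr rfl fun x _ => h x, ← Finset.mul_sum, inv_mul_cancel_left₀ h0]

/-- Teleportation after the Bell measurement is the identity. -/
theorem teleport_bellMeasurement {V : S.ι → D.Op} (hV : IsUnitaryBasis V) :
    teleport V (bellMeasurement V) = LinearMap.id := by
  have h0 : (Fintype.card D.ι : ℂ) ≠ 0 := by exact_mod_cast Fintype.card_ne_zero
  ext1 y
  have h : ∀ s, (of fun i j => bellMeasurement V (FDCStarAlg.kron y (single i j 1)) s s : D.Op) =
      (Fintype.card D.ι : ℂ)⁻¹ • ((V s)ᴴ * y * V s) := by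
    intro s
    ext i j
    rw [of_apply, bellMeasurement_apply, if_pos rfl, Matrix.smul_apply, smul_eq_mul]
    congr 1
    rw [Matrix.mul_assoc]
    simp only [Matrix.mul_apply, conjTranspose_apply, Finset.mul_sum]
    refine (FDCStarAlg.sum_mul_kron_single_mul (fun x => star (V s x.1 x.2))
      (fun x => V s x.1 x.2) y i j).trans ?_
    simp only [mul_assoc]
  have h1 : ∀ s, V s * ((Fintype.card D.ι : ℂ)⁻¹ • ((V s)ᴴ * y * V s)) * (V s)ᴴ =
      (Fintype.card D.ι : ℂ)⁻¹ • y := by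
    intro s
    rw [Matrix.mul_smul, Matrix.smul_mul]
    congr 1
    rw [Matrix.mul_assoc, Matrix.mul_assoc, hV.unitary, Matrix.mul_one, ← Matrix.mul_assoc,
      hV.unitary, Matrix.one_mul]
  -- With `d = dim D`, each of the `d²` outcomes contributes `y / d²`.
  rw [teleport_apply, Finset.sum_congr rfl fun s _ => by rw [h s, h1 s], Finset.sum_const,
    Finset.card_univ, hV.card_eq, ← Complex.coe_smul, ← Nat.cast_smul_eq_nsmul ℂ, smul_smul,
    smul_smul, LinearMap.id_apply]
  push_cast
  convert one_smul ℂ y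
  field_simp

end Teleportation

/-! ### Transferring deficiency through teleportation. -/

section Comparison

variable {A B B' D S E : FDCStarAlg}

theorem id_mem_channels (hD : D.condExp = LinearMap.id) : LinearMap.id ∈ channels D D :=
  hD ▸ condExp_mem_channels

theorem teleport_bellMeasurement_comp {V : S.ι → D.Op} (hV : IsUnitaryBasis V)
    (α : B.Op →ₗ[ℂ] D.Op) :
    teleport V (bellMeasurement V ∘ₗ tensorMap α LinearMap.id) = α := by
  rw [teleport_comp_tensorMap, teleport_bellMeasurement hV, LinearMap.id_comp]

theorem deficientFor_of_tensorMap_id {ε : ℝ} {Ψ : A.Op →ₗ[ℂ] B'.Op} {Φ : A.Op →ₗ[ℂ] B.Op}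
    {V : S.ι → D.Op} (hε : 0 ≤ ε) (hD : D.condExp = LinearMap.id) (hV : IsUnitaryBasis V)
    (hΦ : Φ ∈ channels A B) (hΨ : Ψ ∈ channels A B')
    (h : DeficientFor ε S (tensorMap (F := D) Ψ (LinearMap.id : D.Op →ₗ[ℂ] D.Op))
      (tensorMap (F := D) Φ (LinearMap.id : D.Op →ₗ[ℂ] D.Op))) : DeficientFor ε D Ψ Φ := by
  intro Γ hΓ α hα
  obtain ⟨Γ', hΓ', hf⟩ := exists_hermMaps_pairing_eq (A := A.tensor D) (B := S)
    (pairingLeft Γ ∘ₗ teleport V)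
  have hf' : ∀ β ∈ cpCone (A.tensor D) S, pairing β Γ' = pairing (teleport V β) Γ :=
    fun β hβ => (hf β hβ.1).symm
  have hdual : Γ' ∈ cpDualCone S (A.tensor D) :=
    ⟨hΓ', fun β hβ => (hf' β hβ).symm ▸ hΓ.2 _ (teleport_mem_cpCone hD V hβ)⟩
  have hβ := channels_comp (bellMeasurement_mem_channels hD hV)
    (channels_tensorMap hα (id_mem_channels hD))
  have hΦD := channels_tensorMap hΦ (id_mem_channels hD)
  -- The norm of `Γ'` is attained at a channel, whose teleportation is again a channel.
  have hnorm : dualDiamondNorm S (A.tensor D) Γ' ≤ dualDiamondNorm D A Γ := by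
    obtain ⟨c, hc, hle⟩ := exists_dualDiamondNorm_le_pairing ⟨_, channels_comp hβ hΦD⟩ hdual
    rw [hf' c hc.1] at hle
    exact hle.trans (pairing_le_dualDiamondNorm Γ (teleport_mem_channels hD hV hc))
  obtain ⟨β', hβ', hle⟩ := h Γ' hdual _ hβ
  refine ⟨teleport V β', teleport_mem_channels hD hV hβ', ?_⟩
  rw [hf' _ (channels_comp hβ hΦD).1,
    hf' _ (channels_comp hβ' (channels_tensorMap hΨ (id_mem_channels hD))).1,
    teleport_comp_tensorMap V _ Φ, teleport_comp_tensorMap V _ Ψ,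
    teleport_bellMeasurement_comp hV] at hle
  have := mul_le_mul_of_nonneg_left hnorm hε
  linarith

theorem deficientFor_zero_of_surjective {Ψ : A.Op →ₗ[ℂ] B'.Op} {Φ : A.Op →ₗ[ℂ] B.Op}
    {ξ : E.Op →ₗ[ℂ] D.Op} {V : S.ι → D.Op} (hD : D.condExp = LinearMap.id)
    (hV : IsUnitaryBasis V) (hΦ : Φ ∈ channels A B) (hΨ : Ψ ∈ channels A B')
    (hξ : ξ ∈ channels E D) (hsurj : Function.Surjective ξ)
    (h : DeficientFor 0 S (tensorMap Ψ ξ) (tensorMap Φ ξ)) : DeficientFor 0 D Ψ Φ := by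
  intro Γ hΓ α hα
  -- Only linearity of `η` is used: it undoes `ξ` inside the functional `f`.
  obtain ⟨η, hη⟩ := ξ.exists_rightInverse_of_surjective (LinearMap.range_eq_top.2 hsurj)
  let f : ((A.tensor E).Op →ₗ[ℂ] S.Op) →ₗ[ℝ] ℝ :=
    { toFun := fun β => pairingLeft Γ (teleport V (β ∘ₗ tensorMap LinearMap.id η))
      map_add' := fun β β' => by rw [LinearMap.add_comp, map_add, map_add]
      map_smul' := fun c β => by rw [LinearMap.smul_comp, map_smul, map_smul]; rfl }
  let τ : ((A.tensor E).Op →ₗ[ℂ] S.Op) →ₗ[ℝ] ℝ :=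
    { toFun := fun β => (β 1).trace.re
      map_add' := fun β β' => by simp
      map_smul' := fun c β => by simp }
  have hf : ∀ {B₀ : FDCStarAlg} (φ : A.Op →ₗ[ℂ] B₀.Op) (β : (B₀.tensor D).Op →ₗ[ℂ] S.Op),
      f (β ∘ₗ tensorMap φ ξ) = pairing (teleport V β ∘ₗ φ) Γ := by
    intro B₀ φ β
    change pairing (teleport V ((β ∘ₗ tensorMap φ ξ) ∘ₗ tensorMap LinearMap.id η)) Γ = _
    rw [LinearMap.comp_assoc, ← tensorMap_comp, hη, LinearMap.comp_id, teleport_comp_tensorMap]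
  obtain ⟨C, hC0, hC⟩ := exists_abs_le_mul_trace f
  -- Adding `C • τ` makes the functional nonnegative on CP maps while shifting it by the same
  -- constant on every channel.
  obtain ⟨Γ', hΓ', hF⟩ := exists_hermMaps_pairing_eq (f + C • τ)
  have hdual : Γ' ∈ cpDualCone S (A.tensor E) := by
    refine ⟨hΓ', fun β hβ => ?_⟩
    rw [← hF β hβ.1]
    have := (abs_le.1 (hC β hβ.2)).1
    change 0 ≤ f β + C * (β 1).trace.re
    linarith
  have hchan : ∀ β ∈ channels (A.tensor E) S,
      pairing β Γ' = f β + C * Fintype.card (A.tensor E).ι := by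
    intro β hβ
    rw [← hF β hβ.1.1, ← trace_apply_one_of_mem_channels hβ]
    rfl
  have hβ := channels_comp (bellMeasurement_mem_channels hD hV)
    (channels_tensorMap hα (id_mem_channels hD))
  obtain ⟨β', hβ', hle⟩ := h Γ' hdual _ hβ
  refine ⟨teleport V β', teleport_mem_channels hD hV hβ', ?_⟩
  rw [hchan _ (channels_comp hβ (channels_tensorMap hΦ hξ)),
    hchan _ (channels_comp hβ' (channels_tensorMap hΨ hξ)), hf, hf,
    teleport_bellMeasurement_comp hV] at hle
  linarith

end Comparison

end ChannelComparison

theorem mainTheorem5 (A B B' : ChannelComparison.FDCStarAlg)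
    (Φ : A.Op →ₗ[ℂ] B.Op) (hΦ : Φ ∈ ChannelComparison.channels A B)
    (Ψ : A.Op →ₗ[ℂ] B'.Op) (hΨ : Ψ ∈ ChannelComparison.channels A B')
    (k : ℕ) [NeZero k] :
    (∀ (E : ChannelComparison.FDCStarAlg)
      (ξ : E.Op →ₗ[ℂ] (ChannelComparison.fullAlg k).Op),
      ξ ∈ ChannelComparison.channels E (ChannelComparison.fullAlg k) →
      Function.Surjective ξ →
      ChannelComparison.DeficientFor 0 (ChannelComparison.diagAlg (k ^ 2))
        (ChannelComparison.tensorMap Ψ ξ) (ChannelComparison.tensorMap Φ ξ) →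
      ChannelComparison.DeficientFor 0 (ChannelComparison.fullAlg k) Ψ Φ) ∧
    (∀ ε : ℝ, 0 ≤ ε →
      ChannelComparison.DeficientFor ε (ChannelComparison.diagAlg (k ^ 2))
        (ChannelComparison.tensorMap (F := ChannelComparison.fullAlg k) Ψ
          (LinearMap.id : (ChannelComparison.fullAlg k).Op →ₗ[ℂ] _))
        (ChannelComparison.tensorMap (F := ChannelComparison.fullAlg k) Φ
          (LinearMap.id : (ChannelComparison.fullAlg k).Op →ₗ[ℂ] _)) →
      ChannelComparison.DeficientFor ε (ChannelComparison.fullAlg k) Ψ Φ) ∧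
    (∀ (E F : ChannelComparison.FDCStarAlg) (ξ : E.Op →ₗ[ℂ] F.Op),
      ξ ∈ ChannelComparison.channels E F →
      ∀ ε : ℝ, 0 ≤ ε →
      ChannelComparison.Deficient ε Ψ Φ →
      ChannelComparison.Deficient ε
        (ChannelComparison.tensorMap Ψ ξ) (ChannelComparison.tensorMap Φ ξ)) := by

  have hD := ChannelComparison.FDCStarAlg.condExp_fullAlg k
  obtain ⟨V, hV⟩ := ChannelComparison.exists_isUnitaryBasis k
  have hV' : ChannelComparison.IsUnitaryBasis (d := (ChannelComparison.fullAlg k).ι)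
    (s := (ChannelComparison.diagAlg (k ^ 2)).ι) V := hV
  exact ⟨fun E ξ hξ hsurj h =>
      ChannelComparison.deficientFor_zero_of_surjective hD hV' hΦ hΨ hξ hsurj h,
    fun ε hε h => ChannelComparison.deficientFor_of_tensorMap_id hε hD hV' hΦ hΨ h,
    fun E F ξ hξ ε hε h => ChannelComparison.deficient_tensorMap hε hΦ hΨ hξ h⟩
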